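/- Let $\ell>0$, $\xi\in(-\ell,\ell)$, $a_+<0<a_-$, and let $a^0(x)=a_-$ for $x<\xi$, $a^0(x)=a_+$ for $x>\xi$. Let $\varepsilon_1>0$ and, for $0<\varepsilon<\varepsilon_1$, let $a^\varepsilon\in C^0([-\ell,\ell])$ be real functions such that: **A1.** $a^\varepsilon$ is twice differentiable at every $x\in(-\ell,\ell)$, $x\neq\xi$, with $$\frac{da^\varepsilon}{dx},\ \frac{d^2a^\varepsilon}{dx^2}<0<a^\varepsilon\ \text{ in }(-\ell,\xi),\qquad a^\varepsilon,\ \frac{da^\varepsilon}{dx}<0<\frac{d^2a^\varepsilon}{dx^2}\ \text{ in }(\xi,\ell).$$ **A2.** For every $C>0$ there is $c_0>0$ such that, for all $\varepsilon\in(0,\varepsilon_1)$ and all $x\in(-\ell,\ell)$ with $|x-\xi|\ge c_0\varepsilon$, $$|a^\varepsilon(x)-a^0(x)|\le C\qquad\text{and}\qquad \varepsilon\left|\frac{da^\varepsilon}{dx}(x)\right|\le C.$$ **A3.** The left and right derivatives of $a^\varepsilon$ at $\xi$ exist, and $\liminf_{\varepsilon\to0^+}\varepsilon\left|\frac{da^\varepsilon}{dx}(\xi\pm)\right|>0$.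 Consider the operator $\mathcal L^\varepsilon u=\varepsilon u''-(a^\varepsilon u)'$ in $L^2(-\ell,\ell)$ with Dirichlet boundary conditions $u(\pm\ell)=0$, that is, with domain $H^2(-\ell,\ell)\cap H^1_0(-\ell,\ell)$. Then there exist $C>0$ and $\varepsilon_0\in(0,\varepsilon_1]$ such that for every $\varepsilon\in(0,\varepsilon_0)$ the operator $\mathcal L^\varepsilon$ has a second eigenvalue $\lambda_2^\varepsilon$ (its eigenvalues are real, the largest one $\lambda_1^\varepsilon$ is simple, and $\lambda_2^\varepsilon<\lambda_1^\varepsilon$ is the largest of the others), and $$\lambda_2^\varepsilon\le -\frac{C}{\varepsilon}.$$ -/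

import Mathlib

open MeasureTheory Filter Topology Set

noncomputable section

namespace DiffusionTransport

/-- The step function equal to `am` to the left of `ξ` and to `ap` to the right of `ξ`. -/
def stepFunction (ξ am ap : ℝ) (x : ℝ) : ℝ := if x < ξ then am else ap

/-- Hypothesis A1 for one coefficient `a` on `(-ℓ, ℓ)`: twice differentiable away from `ξ`;
positive, decreasing and concave on `(-ℓ, ξ)`; negative, decreasing and convex on `(ξ, ℓ)`,
all inequalities being strict. -/
structure HypA1 (ℓ ξ : ℝ) (a : ℝ → ℝ) : Prop where
  differentiable : ∀ x ∈ Ioo (-ℓ) ℓ, x ≠ ξ → DifferentiableAt ℝ a x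
  twice_differentiable : ∀ x ∈ Ioo (-ℓ) ℓ, x ≠ ξ → DifferentiableAt ℝ (deriv a) x
  left : ∀ x ∈ Ioo (-ℓ) ξ, deriv a x < 0 ∧ deriv (deriv a) x < 0 ∧ 0 < a x
  right : ∀ x ∈ Ioo ξ ℓ, a x < 0 ∧ deriv a x < 0 ∧ 0 < deriv (deriv a) x

/-- Hypothesis A2 for the family `a ε`, `0 < ε < ε₁`. The constant `c₀` depends on `C` only,
not on `ε` and `x`. -/
def HypA2 (ℓ ξ am ap ε₁ : ℝ) (a : ℝ → ℝ → ℝ) : Prop :=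
  ∀ C : ℝ, 0 < C → ∃ c₀ : ℝ, 0 < c₀ ∧
    ∀ ε ∈ Ioo 0 ε₁, ∀ x ∈ Ioo (-ℓ) ℓ, c₀ * ε ≤ |x - ξ| →
      |a ε x - stepFunction ξ am ap x| ≤ C ∧ ε * |deriv (a ε) x| ≤ C

/-- Hypothesis A3 for the family `a ε`, `0 < ε < ε₁`: the one-sided derivatives at `ξ` exist,
and `ε` times their absolute values have positive lower limits (possibly `+∞`) as `ε → 0+`. -/
structure HypA3 (ξ ε₁ : ℝ) (a : ℝ → ℝ → ℝ) : Prop where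
  left_differentiable : ∀ ε ∈ Ioo 0 ε₁, DifferentiableWithinAt ℝ (a ε) (Iic ξ) ξ
  right_differentiable : ∀ ε ∈ Ioo 0 ε₁, DifferentiableWithinAt ℝ (a ε) (Ici ξ) ξ
  left_liminf :
    0 < liminf (fun ε : ℝ => ((ε * |derivWithin (a ε) (Iic ξ) ξ| : ℝ) : EReal)) (𝓝[>] 0)
  right_liminf :
    0 < liminf (fun ε : ℝ => ((ε * |derivWithin (a ε) (Ici ξ) ξ| : ℝ) : EReal)) (𝓝[>] 0)

/-- `u` belongs to `H²(-ℓ, ℓ) ∩ H¹₀(-ℓ, ℓ)`, with first derivative `du` (absolutely continuous on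
`[-ℓ, ℓ]`) and weak second derivative `d2u ∈ L²(-ℓ, ℓ)`. -/
structure IsH2Dirichlet (ℓ : ℝ) (u du d2u : ℝ → ℂ) : Prop where
  memLp : MemLp d2u 2 (volume.restrict (Ioo (-ℓ) ℓ))
  du_eq : ∀ x ∈ Icc (-ℓ) ℓ, du x = du (-ℓ) + ∫ t in (-ℓ)..x, d2u t
  u_eq : ∀ x ∈ Icc (-ℓ) ℓ, u x = ∫ t in (-ℓ)..x, du t
  u_right : u ℓ = 0

/-- `u` is an eigenfunction, with eigenvalue `lam`, of the operator `u ↦ ε u'' - (a u)'` in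
`L²(-ℓ, ℓ)` with domain `H²(-ℓ, ℓ) ∩ H¹₀(-ℓ, ℓ)`. -/
def IsEigenfunction (ℓ ε : ℝ) (a : ℝ → ℝ) (lam : ℂ) (u : ℝ → ℂ) : Prop :=
  (∃ du d2u : ℝ → ℂ, IsH2Dirichlet ℓ u du d2u ∧
    ∀ᵐ x ∂(volume.restrict (Ioo (-ℓ) ℓ)),
      (ε : ℂ) * d2u x - deriv (fun y => (a y : ℂ) * u y) x = lam * u x) ∧
  ∃ x ∈ Icc (-ℓ) ℓ, u x ≠ 0

/-- `lam` is an eigenvalue of `u ↦ ε u'' - (a u)'` with Dirichlet conditions at `±ℓ`. -/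
def IsEigenvalue (ℓ ε : ℝ) (a : ℝ → ℝ) (lam : ℂ) : Prop :=
  ∃ u : ℝ → ℂ, IsEigenfunction ℓ ε a lam u

/-- The eigenfunctions for `lam` are multiples of each other on `[-ℓ, ℓ]`. -/
def IsSimple (ℓ ε : ℝ) (a : ℝ → ℝ) (lam : ℂ) : Prop :=
  ∀ u v : ℝ → ℂ, IsEigenfunction ℓ ε a lam u → IsEigenfunction ℓ ε a lam v →
    ∃ c : ℂ, ∀ x ∈ Icc (-ℓ) ℓ, v x = c * u x

/-- `lam₂` is the second eigenvalue: there is a larger eigenvalue `lam₁`, which is simple, and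
every other (complex) eigenvalue is real and at most `lam₂`. -/
def IsSecondEigenvalue (ℓ ε : ℝ) (a : ℝ → ℝ) (lam₂ : ℝ) : Prop :=
  IsEigenvalue ℓ ε a (lam₂ : ℂ) ∧
  ∃ lam₁ : ℝ, lam₂ < lam₁ ∧ IsEigenvalue ℓ ε a (lam₁ : ℂ) ∧ IsSimple ℓ ε a (lam₁ : ℂ) ∧
    ∀ ν : ℂ, IsEigenvalue ℓ ε a ν → ν = (lam₁ : ℂ) ∨ (ν.im = 0 ∧ ν.re ≤ lam₂)

end DiffusionTransport

end

/-! With ρ = exp(∫ a / ε), u = ρ v and flux J = ε u' - a u, the eigenvalue equation becomes the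
Sturm–Liouville system v' = J / (ε ρ), J' = λ ρ v with positive weights. So eigenvalues are real,
and for λ = -μ they are read off the Prüfer angle of (v, J) started at 0: its final value is
continuous and strictly increasing in μ, and eigenvalues occur exactly when it is a positive
multiple of π. The value 2π gives the second eigenvalue; there μ > 0, the angle is increasing, and v
changes sign once, at some z (`exists_isSecondEigenvalue`).

One of the nodal intervals (-ℓ, z), (z, ℓ) misses ξ. On it v has a fixed sign and the drift points
towards ξ. In the stretched variable s = ±(x - ξ) / ε ≤ 0, the function exp(-δ (s + e^s)) is a
strict supersolution with rate κ / ε: at distance at least c ε from ξ, A2 bounds the drift below and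
the first order term wins; nearer to ξ, where the drift may be weak, the concavity of -δ e^s wins
(`riccati_le`, `le_of_drift_towards`). A Wronskian comparison with v (`le_of_supersolution`) gives μ
≥ κ / ε, with κ independent of ε. -/

namespace DiffusionTransport

/-! ### Integrating factors and monotonicity -/

/-- A positive solution of the scalar linear equation `E' = c E`. -/
lemma exists_pos_hasDerivAt_mul_self {α β : ℝ} (hαβ : α ≤ β) {c : ℝ → ℝ}
    (hc : ContinuousOn c (Icc α β)) :
    ∃ E : ℝ → ℝ, (∀ x, 0 < E x) ∧ Continuous E ∧
      ∀ x ∈ Icc α β, HasDerivAt E (c x * E x) x := by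
  set c' : ℝ → ℝ := IccExtend hαβ ((Icc α β).domRestrict c) with hc'
  have hcont : Continuous c' := (continuousOn_iff_continuous_domRestrict.1 hc).Icc_extend'
  have hd : ∀ x, HasDerivAt (fun x => Real.exp (∫ t in α..x, c' t))
      (Real.exp (∫ t in α..x, c' t) * c' x) x := fun x =>
    (hcont.integral_hasStrictDerivAt α x).hasDerivAt.exp
  refine ⟨_, fun x => Real.exp_pos _,
    continuous_iff_continuousAt.2 fun x => (hd x).continuousAt, fun x hx => ?_⟩
  have : c' x = c x := by rw [hc', IccExtend_of_mem _ _ hx]; rfl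
  simpa [this, mul_comm] using hd x

lemma monotoneOn_Icc_of_hasDerivAt_nonneg {α β : ℝ} {f f' : ℝ → ℝ}
    (hf : ContinuousOn f (Icc α β)) (hf' : ∀ x ∈ Ioo α β, HasDerivAt f (f' x) x)
    (h0 : ∀ x ∈ Ioo α β, 0 ≤ f' x) : MonotoneOn f (Icc α β) := by
  refine monotoneOn_of_hasDerivWithinAt_nonneg (f' := f') (convex_Icc α β) hf ?_ ?_
  · intro x hx
    rw [interior_Icc] at hx
    exact (hf' x hx).hasDerivWithinAt
  · intro x hx
    rw [interior_Icc] at hx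
    exact h0 x hx

/-- If `f` has nonnegative derivative and does not increase from `α` to `β`, then `f' = 0`. -/
lemma deriv_eq_zero_of_endpoint_le {α β : ℝ} {f f' : ℝ → ℝ}
    (hf : ContinuousOn f (Icc α β)) (hf' : ∀ x ∈ Ioo α β, HasDerivAt f (f' x) x)
    (h0 : ∀ x ∈ Ioo α β, 0 ≤ f' x) (hle : f β ≤ f α) : ∀ x ∈ Ioo α β, f' x = 0 := by
  intro x hx
  have hm := monotoneOn_Icc_of_hasDerivAt_nonneg hf hf' h0
  have hαβ : α ≤ β := (hx.1.trans hx.2).le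
  have hconst : f =ᶠ[𝓝 x] fun _ => f α := by
    filter_upwards [Ioo_mem_nhds hx.1 hx.2] with y hy
    have h1 := hm (left_mem_Icc.2 hαβ) (Ioo_subset_Icc_self hy) hy.1.le
    have h2 := hm (Ioo_subset_Icc_self hy) (right_mem_Icc.2 hαβ) hy.2.le
    linarith
  exact (hf' x hx).unique ((hasDerivAt_const x (f α)).congr_of_eventuallyEq hconst)

/-! ### The Prüfer equation: comparison and existence -/

/-- The right-hand side of the Prüfer equation. -/
noncomputable def angleField (P Q : ℝ → ℝ) (x θ : ℝ) : ℝ :=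
  P x * Real.cos θ ^ 2 + Q x * Real.sin θ ^ 2

/-- `θ` solves the Prüfer equation on `[α, β]`. -/
structure IsAngle (α β : ℝ) (P Q θ : ℝ → ℝ) : Prop where
  continuousOn : ContinuousOn θ (Icc α β)
  hasDerivAt : ∀ x ∈ Ioo α β, HasDerivAt θ (angleField P Q x (θ x)) x

/-- From sin² t - sin² s = sin (t - s) sin (t + s). Writing sin (t - s) with `sinc` keeps the
coefficient of t - s continuous where t = s, so the difference of two angles solves a linear
equation. -/
lemma angleField_sub (P Q : ℝ → ℝ) (x s t : ℝ) :
    angleField P Q x t - angleField P Q x s =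
      ((Q x - P x) * Real.sinc (t - s) * Real.sin (t + s)) * (t - s) := by
  have h : Real.sinc (t - s) * (t - s) = Real.sin (t - s) := by
    by_cases h : t - s = 0
    · simp [h]
    · rw [Real.sinc_of_ne_zero h]; field_simp
  have h2 : Real.sin (t - s) * Real.sin (t + s) = Real.sin t ^ 2 - Real.sin s ^ 2 := by
    rw [Real.sin_sub, Real.sin_add]
    have h1 := Real.sin_sq_add_cos_sq s
    have h2 := Real.sin_sq_add_cos_sq t
    linear_combination Real.sin t ^ 2 * h1 - Real.sin s ^ 2 * h2
  have e : ((Q x - P x) * Real.sinc (t - s) * Real.sin (t + s)) * (t - s)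
      = (Q x - P x) * (Real.sin t ^ 2 - Real.sin s ^ 2) := by
    rw [← h2, ← h]; ring
  rw [e, angleField, angleField, Real.cos_sq', Real.cos_sq']
  ring

/-- Comparison of two Prüfer angles: their difference, multiplied by a positive integrating
factor, has an explicit nonnegative derivative. -/
lemma IsAngle.exists_factor {α β : ℝ} (hαβ : α ≤ β) {P₁ Q₁ P₂ Q₂ θ₁ θ₂ : ℝ → ℝ}
    (hP₂ : Continuous P₂) (hQ₂ : Continuous Q₂)
    (h₁ : IsAngle α β P₁ Q₁ θ₁) (h₂ : IsAngle α β P₂ Q₂ θ₂) :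
    ∃ E : ℝ → ℝ, (∀ x, 0 < E x) ∧ ContinuousOn (fun x => E x * (θ₂ x - θ₁ x)) (Icc α β) ∧
      ∀ x ∈ Ioo α β, HasDerivAt (fun x => E x * (θ₂ x - θ₁ x))
        (E x * (angleField P₂ Q₂ x (θ₁ x) - angleField P₁ Q₁ x (θ₁ x))) x := by
  have hc : ContinuousOn (fun x => -((Q₂ x - P₂ x) * Real.sinc (θ₂ x - θ₁ x) *
      Real.sin (θ₂ x + θ₁ x))) (Icc α β) := by
    refine ContinuousOn.neg (ContinuousOn.mul (ContinuousOn.mul ?_ ?_) ?_)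
    · exact (hQ₂.sub hP₂).continuousOn
    · exact Real.continuous_sinc.comp_continuousOn (h₂.continuousOn.sub h₁.continuousOn)
    · exact Real.continuous_sin.comp_continuousOn (h₂.continuousOn.add h₁.continuousOn)
  obtain ⟨E, hE, hEc, hE'⟩ := exists_pos_hasDerivAt_mul_self hαβ hc
  refine ⟨E, hE, hEc.continuousOn.mul (h₂.continuousOn.sub h₁.continuousOn), fun x hx => ?_⟩
  have := (hE' x (Ioo_subset_Icc_self hx)).mul ((h₂.hasDerivAt x hx).sub (h₁.hasDerivAt x hx))
  convert! this using 1
  have := angleField_sub P₂ Q₂ x (θ₁ x) (θ₂ x)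
  simp only [Pi.sub_apply]
  linear_combination - E x * this

lemma angleField_mono {P₁ Q₁ P₂ Q₂ : ℝ → ℝ} {x : ℝ} (hP : P₁ x ≤ P₂ x) (hQ : Q₁ x ≤ Q₂ x)
    (θ : ℝ) : angleField P₁ Q₁ x θ ≤ angleField P₂ Q₂ x θ := by
  unfold angleField
  gcongr

/-- Strict comparison at the right endpoint. -/
lemma IsAngle.lt_right {α β : ℝ} (hαβ : α ≤ β) {P₁ Q₁ P₂ Q₂ θ₁ θ₂ : ℝ → ℝ}
    (hP₂ : Continuous P₂) (hQ₂ : Continuous Q₂)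
    (h₁ : IsAngle α β P₁ Q₁ θ₁) (h₂ : IsAngle α β P₂ Q₂ θ₂)
    (hP : ∀ x ∈ Ioo α β, P₁ x ≤ P₂ x) (hQ : ∀ x ∈ Ioo α β, Q₁ x ≤ Q₂ x) (hα : θ₁ α ≤ θ₂ α)
    (hlt : θ₁ α < θ₂ α ∨
      ∃ x ∈ Ioo α β, angleField P₁ Q₁ x (θ₁ x) < angleField P₂ Q₂ x (θ₁ x)) :
    θ₁ β < θ₂ β := by
  obtain ⟨E, hE, hEc, hE'⟩ := IsAngle.exists_factor hαβ hP₂ hQ₂ h₁ h₂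
  have h0 : ∀ y ∈ Ioo α β,
      0 ≤ E y * (angleField P₂ Q₂ y (θ₁ y) - angleField P₁ Q₁ y (θ₁ y)) := fun y hy =>
    mul_nonneg (hE y).le (sub_nonneg.2 (angleField_mono (hP y hy) (hQ y hy) _))
  have hm := monotoneOn_Icc_of_hasDerivAt_nonneg hEc hE' h0
    (left_mem_Icc.2 hαβ) (right_mem_Icc.2 hαβ) hαβ
  have hα0 : 0 ≤ E α * (θ₂ α - θ₁ α) := mul_nonneg (hE α).le (sub_nonneg.2 hα)
  -- Otherwise the nondecreasing function E (θ₂ - θ₁) starts ≥ 0 and ends ≤ 0, so it is constantly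
  -- 0, against either form of strictness.
  by_contra! hle
  have hβ : E β * (θ₂ β - θ₁ β) ≤ 0 :=
    mul_nonpos_of_nonneg_of_nonpos (hE β).le (sub_nonpos.2 hle)
  rcases hlt with hlt | ⟨x, hx, hlt⟩
  · have : 0 < E α * (θ₂ α - θ₁ α) := mul_pos (hE α) (sub_pos.2 hlt)
    simp only at hm
    linarith
  · have := deriv_eq_zero_of_endpoint_le hEc hE' h0 (by linarith) x hx
    have := mul_pos (hE x) (sub_pos.2 hlt)
    linarith

lemma abs_angleField_sub_le (P Q : ℝ → ℝ) (x s t : ℝ) :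
    |angleField P Q x t - angleField P Q x s| ≤ (|P x| + |Q x|) * |t - s| := by
  rw [angleField_sub, abs_mul, abs_mul, abs_mul]
  have h1 : |Q x - P x| ≤ |P x| + |Q x| := by
    rw [add_comm]; exact abs_sub _ _
  have h2 := Real.abs_sinc_le_one (t - s)
  have h3 := Real.abs_sin_le_one (t + s)
  gcongr
  calc |Q x - P x| * |Real.sinc (t - s)| * |Real.sin (t + s)|
      ≤ (|P x| + |Q x|) * 1 * 1 := by gcongr
    _ = _ := by ring

lemma abs_angleField_le (P Q : ℝ → ℝ) (x t : ℝ) : |angleField P Q x t| ≤ |P x| + |Q x| := by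
  unfold angleField
  refine (abs_add_le _ _).trans ?_
  rw [abs_mul, abs_mul, abs_of_nonneg (sq_nonneg (Real.cos t)), abs_of_nonneg (sq_nonneg (Real.sin t))]
  have h1 := Real.cos_sq_le_one t
  have h2 := Real.sin_sq_le_one t
  calc _ ≤ |P x| * 1 + |Q x| * 1 := by gcongr
    _ = _ := by ring

/-- The initial value problem for the Prüfer equation is solvable on the whole interval. -/
lemma exists_isAngle {α β : ℝ} (hαβ : α ≤ β) {P Q : ℝ → ℝ} (hP : Continuous P)
    (hQ : Continuous Q) :
    ∃ θ : ℝ → ℝ, θ α = 0 ∧ ContinuousOn θ (Icc α β) ∧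
      ∀ x ∈ Icc α β, HasDerivAt θ (angleField P Q x (θ x)) x := by
  -- The margin 1 on each side gives two-sided derivatives at α and β. The bound B serves both as
  -- Lipschitz constant and as speed bound.
  obtain ⟨B, hB⟩ := (isCompact_Icc (a := α - 1) (b := β + 1)).exists_bound_of_continuousOn
    (f := fun x => |P x| + |Q x|) (by fun_prop)
  have hB' : ∀ x ∈ Icc (α - 1) (β + 1), |P x| + |Q x| ≤ B := fun x hx =>
    (le_abs_self _).trans (hB x hx)
  have hB0 : 0 ≤ B := by
    exact (by positivity : 0 ≤ |P α| + |Q α|).trans (hB' α ⟨by linarith, by linarith⟩)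
  lift B to NNReal using hB0
  set R : NNReal := B * Real.toNNReal (β - α + 2) with hR
  have hα : α ∈ Icc (α - 1) (β + 1) := ⟨by linarith, by linarith⟩
  have hpl : IsPicardLindelof (angleField P Q) (⟨α, hα⟩ : Icc (α - 1) (β + 1)) 0 R 0 B B := by
    refine ⟨fun t ht => ?_, fun x _ => ?_, fun t ht x _ => ?_, ?_⟩
    · refine LipschitzOnWith.of_dist_le_mul fun x _ y _ => ?_
      rw [Real.dist_eq, Real.dist_eq]
      exact (abs_angleField_sub_le P Q t y x).trans (by gcongr; exact hB' t ht)
    · unfold angleField; fun_prop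
    · exact (abs_angleField_le P Q t x).trans (hB' t ht)
    · simp only [hR, NNReal.coe_mul, NNReal.coe_zero, sub_zero]
      rw [Real.coe_toNNReal _ (by linarith)]
      gcongr
      exact max_le (by linarith) (by linarith)
  obtain ⟨θ, h0, hθ⟩ := hpl.exists_eq_forall_mem_Icc_hasDerivWithinAt₀
  have hd : ∀ x ∈ Icc α β, HasDerivAt θ (angleField P Q x (θ x)) x := fun x hx =>
    (hθ x ⟨by linarith [hx.1], by linarith [hx.2]⟩).hasDerivAt
      (Icc_mem_nhds (by linarith [hx.1]) (by linarith [hx.2]))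
  exact ⟨θ, h0, fun x hx => (hd x hx).continuousAt.continuousWithinAt, hd⟩

/-! ### Dependence of the final angle on the parameter -/

/-- For every `μ`, `θ μ` is the Prüfer angle of the equation `(v' / P)' + μ ρ v = 0`, started at
`0` in `α`. -/
structure IsAngleFamily (α β : ℝ) (P ρ : ℝ → ℝ) (θ : ℝ → ℝ → ℝ) : Prop where
  left : ∀ μ, θ μ α = 0
  continuousOn : ∀ μ, ContinuousOn (θ μ) (Icc α β)
  hasDerivAt : ∀ μ, ∀ x ∈ Icc α β,
    HasDerivAt (θ μ) (angleField P (fun y => μ * ρ y) x (θ μ x)) x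

lemma exists_isAngleFamily {α β : ℝ} (hαβ : α ≤ β) {P ρ : ℝ → ℝ} (hP : Continuous P)
    (hρ : Continuous ρ) : ∃ θ, IsAngleFamily α β P ρ θ := by
  choose θ h1 h2 h3 using fun μ : ℝ =>
    exists_isAngle hαβ (Q := fun y => μ * ρ y) hP (by fun_prop)
  exact ⟨θ, h1, h2, h3⟩

/-- The time needed for an angle to make a full turn under the constant coefficient equation tends
to zero as `μ → ∞`. -/
lemma tendsto_integral_inv_angleField {p q : ℝ} (hp : 0 < p)
    (hq : 0 < q) :
    Tendsto (fun μ : ℝ => ∫ t in (0 : ℝ)..(2 * Real.pi),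
      (p * Real.cos t ^ 2 + μ * q * Real.sin t ^ 2)⁻¹) atTop (𝓝 0) := by
  have hlow : ∀ μ, p / q ≤ μ → ∀ t, p ≤ p * Real.cos t ^ 2 + μ * q * Real.sin t ^ 2 := by
    intro μ hμ t
    have : p ≤ μ * q := by rwa [div_le_iff₀ hq] at hμ
    have h2 := mul_le_mul_of_nonneg_right this (sq_nonneg (Real.sin t))
    have h3 : p * Real.cos t ^ 2 + p * Real.sin t ^ 2 = p := by
      rw [← mul_add, Real.cos_sq_add_sin_sq, mul_one]
    linarith
  have := intervalIntegral.tendsto_integral_filter_of_dominated_convergence (μ := volume)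
    (a := 0) (b := 2 * Real.pi) (l := (atTop : Filter ℝ))
    (F := fun μ t => (p * Real.cos t ^ 2 + μ * q * Real.sin t ^ 2)⁻¹) (f := fun _ => 0)
    (fun _ => p⁻¹) ?_ ?_ intervalIntegrable_const ?_
  · simpa using this
  · exact Eventually.of_forall fun μ => Measurable.aestronglyMeasurable (by fun_prop)
  · filter_upwards [eventually_ge_atTop (p / q)] with μ hμ
    refine Eventually.of_forall fun t _ => ?_
    have := hlow μ hμ t
    rw [Real.norm_of_nonneg (inv_nonneg.2 (hp.le.trans this))]
    exact inv_anti₀ hp this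
  -- The integrand tends to 0 wherever sin t ≠ 0, that is, off a countable set.
  · have hcount : (range fun n : ℤ => (n : ℝ) * Real.pi).Countable := countable_range _
    filter_upwards [hcount.ae_notMem volume] with t ht _
    have hs : Real.sin t ≠ 0 := fun h0 => ht (Real.sin_eq_zero_iff.1 h0)
    have hs2 : 0 < q * Real.sin t ^ 2 := by positivity
    refine tendsto_inv_atTop_zero.comp (tendsto_atTop_add_const_left _ _ ?_)
    simp_rw [mul_assoc]
    exact tendsto_id.atTop_mul_const hs2

namespace IsAngleFamily

variable {α β : ℝ} {P ρ : ℝ → ℝ} {θ : ℝ → ℝ → ℝ}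

lemma isAngle (h : IsAngleFamily α β P ρ θ) (μ : ℝ) :
    IsAngle α β P (fun y => μ * ρ y) (θ μ) :=
  ⟨h.continuousOn μ, fun x hx => h.hasDerivAt μ x (Ioo_subset_Icc_self hx)⟩

/-- Comparison with the constant angle 0, which solves the equation with P replaced by 0; the field
at angle 0 equals P > 0. -/
lemma pos_right (h : IsAngleFamily α β P ρ θ) (hαβ : α < β) (hP : Continuous P)
    (hρ : Continuous ρ) (hP0 : ∀ x, 0 < P x) (μ : ℝ) : 0 < θ μ β := by
  have h0 : IsAngle α β (fun _ => 0) (fun y => μ * ρ y) (fun _ => 0) :=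
    ⟨continuousOn_const, fun x _ => by simpa [angleField] using hasDerivAt_const x (0 : ℝ)⟩
  obtain ⟨x, hx⟩ := exists_between hαβ
  exact h0.lt_right hαβ.le hP (by fun_prop) (h.isAngle μ) (fun x _ => (hP0 x).le)
    (fun x _ => le_rfl) (h.left μ).ge (Or.inr ⟨x, hx, by simpa [angleField] using hP0 x⟩)

/-- For μ = 0 the constant π/2 is a solution, and an angle started at 0 stays below it. This makes
every parameter with final angle at least π positive. -/
lemma zero_right_lt (h : IsAngleFamily α β P ρ θ) (hαβ : α < β) (hP : Continuous P) :
    θ 0 β < Real.pi := by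
  have h0 : IsAngle α β P (fun _ => 0) (fun _ => Real.pi / 2) :=
    ⟨continuousOn_const, fun x _ => by simpa [angleField] using hasDerivAt_const x (Real.pi / 2)⟩
  have hlt := (h.isAngle 0).lt_right hαβ.le hP continuous_const h0 (fun x _ => le_rfl)
    (fun x _ => by simp) (by rw [h.left]; positivity)
    (Or.inl (by rw [h.left]; positivity))
  linarith [Real.pi_pos]

/-- Where sin θ vanishes, its derivative is P cos³ θ ≠ 0. The parameter enters the field only
through ρ sin² θ, so this supplies strictness in μ. -/
lemma exists_sin_ne_zero (h : IsAngleFamily α β P ρ θ) (hαβ : α < β)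
    (hP0 : ∀ x, 0 < P x) (μ : ℝ) : ∃ x ∈ Ioo α β, Real.sin (θ μ x) ≠ 0 := by
  by_contra! hs
  obtain ⟨x, hx⟩ := exists_between hαβ
  have hd := (h.hasDerivAt μ x (Ioo_subset_Icc_self hx)).sin
  have h0 : (fun y => Real.sin (θ μ y)) =ᶠ[𝓝 x] fun _ => 0 := by
    filter_upwards [Ioo_mem_nhds hx.1 hx.2] with y hy using hs y hy
  have := hd.unique ((hasDerivAt_const x (0 : ℝ)).congr_of_eventuallyEq h0)
  have hsx := hs x hx
  have hc : Real.cos (θ μ x) ≠ 0 := by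
    intro hc
    have := Real.sin_sq_add_cos_sq (θ μ x)
    rw [hc, hsx] at this
    norm_num at this
  have := (hP0 x).ne'
  simp_all [angleField]

lemma strictMono_right (h : IsAngleFamily α β P ρ θ) (hαβ : α < β) (hP : Continuous P)
    (hρ : Continuous ρ) (hP0 : ∀ x, 0 < P x) (hρ0 : ∀ x, 0 < ρ x) :
    StrictMono fun μ => θ μ β := by
  intro μ ν hμν
  obtain ⟨x, hx, hs⟩ := h.exists_sin_ne_zero hαβ hP0 μ
  refine (h.isAngle μ).lt_right hαβ.le hP (by fun_prop) (h.isAngle ν) (fun x _ => le_rfl)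
    (fun x _ => mul_le_mul_of_nonneg_right hμν.le (hρ0 x).le) (by simp [h.left])
    (Or.inr ⟨x, hx, ?_⟩)
  have hs2 : 0 < Real.sin (θ μ x) ^ 2 := by positivity
  simp only [angleField]
  have := hρ0 x
  gcongr

/-- Grönwall: the angle for ν solves the equation for μ up to a defect of at most |ν - μ| sup ρ. -/
lemma continuous_right (h : IsAngleFamily α β P ρ θ) (hαβ : α < β) (hP : Continuous P)
    (hρ : Continuous ρ) : Continuous fun μ => θ μ β := by
  rw [continuous_iff_continuousAt]
  intro μ
  obtain ⟨B, hB⟩ := (isCompact_Icc (a := α) (b := β)).exists_bound_of_continuousOn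
    (f := fun x => |P x| + |μ * ρ x|) (by fun_prop)
  obtain ⟨D, hD⟩ := (isCompact_Icc (a := α) (b := β)).exists_bound_of_continuousOn
    (f := ρ) (by fun_prop)
  have hB0 : 0 ≤ B := (norm_nonneg _).trans (hB α (left_mem_Icc.2 hαβ.le))
  lift B to NNReal using hB0
  have key : ∀ ν, dist (θ ν β) (θ μ β) ≤ gronwallBound 0 B (|ν - μ| * D + 0) (β - α) := by
    intro ν
    refine dist_le_of_approx_trajectories_ODE_of_mem
      (v := fun t y => angleField P (fun z => μ * ρ z) t y) (s := fun _ => univ)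
      (f' := fun x => angleField P (fun z => ν * ρ z) x (θ ν x))
      (g' := fun x => angleField P (fun z => μ * ρ z) x (θ μ x))
      ?_ (h.continuousOn ν) (fun t ht => (h.hasDerivAt ν t ⟨ht.1, ht.2.le⟩).hasDerivWithinAt) ?_
      (fun _ _ => mem_univ _) (h.continuousOn μ)
      (fun t ht => (h.hasDerivAt μ t ⟨ht.1, ht.2.le⟩).hasDerivWithinAt) ?_
      (fun _ _ => mem_univ _) ?_ β (right_mem_Icc.2 hαβ.le)
    · intro t ht
      refine LipschitzOnWith.of_dist_le_mul fun x _ y _ => ?_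
      rw [Real.dist_eq, Real.dist_eq]
      refine (abs_angleField_sub_le P _ t y x).trans ?_
      gcongr
      exact (le_abs_self _).trans (hB t ⟨ht.1, ht.2.le⟩)
    · intro t ht
      have e : angleField P (fun z => ν * ρ z) t (θ ν t) - angleField P (fun z => μ * ρ z) t (θ ν t)
          = (ν - μ) * ρ t * Real.sin (θ ν t) ^ 2 := by simp only [angleField]; ring
      rw [Real.dist_eq, e, abs_mul, abs_mul, abs_of_nonneg (sq_nonneg (Real.sin _))]
      have h1 := Real.sin_sq_le_one (θ ν t)
      have h2 : |ρ t| ≤ D := hD t ⟨ht.1, ht.2.le⟩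
      calc _ ≤ |ν - μ| * |ρ t| * 1 := by gcongr
        _ ≤ _ := by rw [mul_one]; gcongr
    · intro t _
      simp
    · simp [h.left]
  rw [ContinuousAt, tendsto_iff_dist_tendsto_zero]
  refine squeeze_zero (fun _ => dist_nonneg) key ?_
  have hc : Continuous fun ν => gronwallBound 0 B (|ν - μ| * D + 0) (β - α) :=
    (gronwallBound_continuous_ε 0 B (β - α)).comp (by fun_prop)
  have := hc.tendsto μ
  simpa [gronwallBound_ε0_δ0] using this

/-- With P ≥ p and ρ ≥ q the angle moves at least at the speed w(θ) of the constant coefficient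
equation, so ∫ dt / w over [0, θ(x)] grows at least as fast as x. If the angle ended at or below 2π,
the time of a full turn would be at least β - α, which fails for large μ. -/
lemma exists_two_pi_lt_right (h : IsAngleFamily α β P ρ θ) (hαβ : α < β) (hP : Continuous P)
    (hρ : Continuous ρ) (hP0 : ∀ x, 0 < P x) (hρ0 : ∀ x, 0 < ρ x) :
    ∃ μ, 2 * Real.pi < θ μ β := by
  obtain ⟨p, hp, hpP⟩ : ∃ p, 0 < p ∧ ∀ x ∈ Icc α β, p ≤ P x := by
    obtain ⟨x, _, hx⟩ := isCompact_Icc.exists_isMinOn (nonempty_Icc.2 hαβ.le) hP.continuousOn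
    exact ⟨P x, hP0 x, fun y hy => hx hy⟩
  obtain ⟨q, hq, hqρ⟩ : ∃ q, 0 < q ∧ ∀ x ∈ Icc α β, q ≤ ρ x := by
    obtain ⟨x, _, hx⟩ := isCompact_Icc.exists_isMinOn (nonempty_Icc.2 hαβ.le) hρ.continuousOn
    exact ⟨ρ x, hρ0 x, fun y hy => hx hy⟩
  obtain ⟨μ, hμ, hμ0⟩ := (((tendsto_integral_inv_angleField hp hq).eventually
    (gt_mem_nhds (sub_pos.2 hαβ))).and (eventually_gt_atTop 0)).exists
  refine ⟨μ, ?_⟩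
  by_contra! hle
  set w : ℝ → ℝ := fun t => p * Real.cos t ^ 2 + μ * q * Real.sin t ^ 2 with hw
  have hw0 : ∀ t, 0 < w t := by
    intro t
    have h1 : 0 < μ * q := by positivity
    rcases eq_or_ne (Real.sin t) 0 with hs | hs
    · have := Real.sin_sq_add_cos_sq t
      rw [hs] at this
      have hc : Real.cos t ^ 2 = 1 := by linarith
      simp [hw, hs, hc, hp]
    · have : 0 < Real.sin t ^ 2 := by positivity
      simp only [hw]; positivity
  have hwc : Continuous fun t => (w t)⁻¹ :=
    Continuous.inv₀ (by simp only [hw]; fun_prop) fun t => (hw0 t).ne'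
  have hd : ∀ x ∈ Icc α β, HasDerivAt (fun x => (∫ t in (0 : ℝ)..(θ μ x), (w t)⁻¹) - x)
      ((w (θ μ x))⁻¹ * angleField P (fun y => μ * ρ y) x (θ μ x) - 1) x := fun x hx =>
    (((hwc.integral_hasStrictDerivAt 0 (θ μ x)).hasDerivAt.comp x (h.hasDerivAt μ x hx))).sub
      (hasDerivAt_id x)
  have hmono := monotoneOn_Icc_of_hasDerivAt_nonneg
    (fun x hx => (hd x hx).continuousAt.continuousWithinAt)
    (fun x hx => hd x (Ioo_subset_Icc_self hx)) fun x hx => by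
      have hx' := Ioo_subset_Icc_self hx
      have : w (θ μ x) ≤ angleField P (fun y => μ * ρ y) x (θ μ x) := by
        simp only [hw, angleField]
        have := hpP x hx'
        have := hqρ x hx'
        gcongr
      rw [sub_nonneg, inv_mul_eq_div, one_le_div (hw0 _)]
      exact this
  have hαβ' := hmono (left_mem_Icc.2 hαβ.le) (right_mem_Icc.2 hαβ.le) hαβ.le
  simp only [h.left, intervalIntegral.integral_same] at hαβ'
  have hintegrable : (∫ t in (0 : ℝ)..(θ μ β), (w t)⁻¹) ≤ ∫ t in (0 : ℝ)..(2 * Real.pi), (w t)⁻¹ := by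
    rw [← intervalIntegral.integral_add_adjacent_intervals
      (hwc.intervalIntegrable 0 (θ μ β)) (hwc.intervalIntegrable (θ μ β) (2 * Real.pi))]
    have := intervalIntegral.integral_nonneg hle (fun t _ => (inv_pos.2 (hw0 t)).le) (μ := volume)
    linarith
  linarith

/-- Every value between `π` and `2π` is attained by the final angle, at a positive parameter. -/
lemma exists_right_eq (h : IsAngleFamily α β P ρ θ) (hαβ : α < β) (hP : Continuous P)
    (hρ : Continuous ρ) (hP0 : ∀ x, 0 < P x) (hρ0 : ∀ x, 0 < ρ x) {s : ℝ}
    (hs : s ∈ Icc Real.pi (2 * Real.pi)) : ∃ μ, 0 < μ ∧ θ μ β = s := by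
  obtain ⟨M, hM⟩ := h.exists_two_pi_lt_right hαβ hP hρ hP0 hρ0
  have h0 := h.zero_right_lt hαβ hP
  have hmono := h.strictMono_right hαβ hP hρ hP0 hρ0
  obtain ⟨μ, hμ⟩ := mem_range_of_exists_le_of_exists_ge (h.continuous_right hαβ hP hρ)
    ⟨0, (h0.le.trans hs.1)⟩ ⟨M, hs.2.trans hM.le⟩
  refine ⟨μ, ?_, hμ⟩
  rw [← hmono.lt_iff_lt]
  exact (h0.trans_le hs.1).trans_eq hμ.symm

end IsAngleFamily

/-! ### The first order system: reality, uniqueness, supersolutions -/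

/-- `(v, J)` solves the first order system `v' = P J`, `J' = lam ρ v` on `[α, β]`. -/
structure IsSolution (α β : ℝ) (P ρ : ℝ → ℝ) (lam : ℂ) (v J : ℝ → ℂ) : Prop where
  continuousOn_v : ContinuousOn v (Icc α β)
  continuousOn_J : ContinuousOn J (Icc α β)
  hasDerivAt_v : ∀ x ∈ Ioo α β, HasDerivAt v ((P x : ℂ) * J x) x
  hasDerivAt_J : ∀ x ∈ Ioo α β, HasDerivAt J (lam * ρ x * v x) x

lemma hasDerivAt_re {f : ℝ → ℂ} {f' : ℂ} {x : ℝ} (h : HasDerivAt f f' x) :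
    HasDerivAt (fun y => (f y).re) f'.re x :=
  Complex.reCLM.hasFDerivAt.comp_hasDerivAt x h

lemma hasDerivAt_im {f : ℝ → ℂ} {f' : ℂ} {x : ℝ} (h : HasDerivAt f f' x) :
    HasDerivAt (fun y => (f y).im) f'.im x :=
  Complex.imCLM.hasFDerivAt.comp_hasDerivAt x h

lemma eq_left_of_hasDerivAt_zero {α β : ℝ} {f : ℝ → ℂ} (hf : ContinuousOn f (Icc α β))
    (hf' : ∀ x ∈ Ioo α β, HasDerivAt f 0 x) : ∀ x ∈ Icc α β, f x = f α := by
  have key : ∀ g : ℝ → ℝ, ContinuousOn g (Icc α β) → (∀ x ∈ Ioo α β, HasDerivAt g 0 x) →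
      ∀ x ∈ Icc α β, g x = g α := by
    intro g hg hg' x hx
    have hα : α ∈ Icc α β := ⟨le_rfl, hx.1.trans hx.2⟩
    have h1 := monotoneOn_Icc_of_hasDerivAt_nonneg (f' := fun _ => 0) hg hg' (fun _ _ => le_rfl)
      hα hx hx.1
    have h2 := monotoneOn_Icc_of_hasDerivAt_nonneg (f := fun x => -g x) (f' := fun _ => 0) hg.neg
      (fun x hx => by simpa using (hg' x hx).fun_neg) (fun _ _ => le_rfl) hα hx hx.1
    simp only at h2
    linarith
  intro x hx
  apply Complex.ext
  · exact key (fun y => (f y).re) (Complex.continuous_re.comp_continuousOn hf)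
      (fun y hy => by simpa using hasDerivAt_re (hf' y hy)) x hx
  · exact key (fun y => (f y).im) (Complex.continuous_im.comp_continuousOn hf)
      (fun y hy => by simpa using hasDerivAt_im (hf' y hy)) x hx

/-- The eigenvalues of the Dirichlet problem are real. -/
lemma IsSolution.im_eq_zero {α β : ℝ} {P ρ : ℝ → ℝ} {lam : ℂ} {v J : ℝ → ℂ}
    (h : IsSolution α β P ρ lam v J) (hρ0 : ∀ x, 0 < ρ x) (hα : v α = 0) (hβ : v β = 0)
    (hne : ∃ x ∈ Icc α β, v x ≠ 0) : lam.im = 0 := by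
  by_contra him
  -- Lagrange identity: f = Im λ · Im (J v̄) vanishes at both ends and has derivative (Im λ)² ρ
  -- |v|².
  set f : ℝ → ℝ := fun x => lam.im * ((J x).im * (v x).re - (J x).re * (v x).im) with hf
  have hfc : ContinuousOn f (Icc α β) := by
    have h1 := Complex.continuous_re.comp_continuousOn h.continuousOn_v
    have h2 := Complex.continuous_im.comp_continuousOn h.continuousOn_v
    have h3 := Complex.continuous_re.comp_continuousOn h.continuousOn_J
    have h4 := Complex.continuous_im.comp_continuousOn h.continuousOn_J
    exact continuousOn_const.mul ((h4.mul h1).sub (h3.mul h2))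
  have hfd : ∀ x ∈ Ioo α β, HasDerivAt f (lam.im ^ 2 * ρ x * ((v x).re ^ 2 + (v x).im ^ 2)) x := by
    intro x hx
    have hv := h.hasDerivAt_v x hx
    have hJ := h.hasDerivAt_J x hx
    have := (((hasDerivAt_im hJ).mul (hasDerivAt_re hv)).sub
      ((hasDerivAt_re hJ).mul (hasDerivAt_im hv))).const_mul lam.im
    convert! this using 1
    simp only [Complex.mul_re, Complex.mul_im, Complex.ofReal_re, Complex.ofReal_im]
    ring
  have hz := deriv_eq_zero_of_endpoint_le hfc hfd
    (fun x _ => by have := hρ0 x; positivity) (by simp [hf, hα, hβ])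
  obtain ⟨x, hx, hvx⟩ := hne
  have hxα : x ≠ α := by rintro rfl; exact hvx hα
  have hxβ : x ≠ β := by rintro rfl; exact hvx hβ
  have := hz x ⟨lt_of_le_of_ne hx.1 hxα.symm, lt_of_le_of_ne hx.2 hxβ⟩
  have h1 := (hρ0 x).ne'
  have h2 : (v x).re ^ 2 + (v x).im ^ 2 = 0 := by
    simpa [him, h1] using this
  apply hvx
  apply Complex.ext
  · simp only [Complex.zero_re]; nlinarith [sq_nonneg (v x).re, sq_nonneg (v x).im]
  · simp only [Complex.zero_im]; nlinarith [sq_nonneg (v x).re, sq_nonneg (v x).im]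

/-- The Prüfer amplitude belonging to a Prüfer angle. -/
lemma exists_amplitude {α β : ℝ} (hαβ : α ≤ β) {P Q θ : ℝ → ℝ} (hP : Continuous P)
    (hQ : Continuous Q) (hθ : ∀ x ∈ Icc α β, HasDerivAt θ (angleField P Q x (θ x)) x) :
    ∃ r : ℝ → ℝ, (∀ x, 0 < r x) ∧
      (∀ x ∈ Icc α β, HasDerivAt (fun x => r x * Real.sin (θ x))
        (P x * (r x * Real.cos (θ x))) x) ∧
      ∀ x ∈ Icc α β, HasDerivAt (fun x => r x * Real.cos (θ x))
        (-Q x * (r x * Real.sin (θ x))) x := by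
  have hθc : ContinuousOn θ (Icc α β) := fun x hx => (hθ x hx).continuousAt.continuousWithinAt
  -- The system for (r sin θ, r cos θ) forces r' = (P - Q) sin θ cos θ · r.
  have hc : ContinuousOn (fun x => (P x - Q x) * Real.sin (θ x) * Real.cos (θ x)) (Icc α β) :=
    ((hP.sub hQ).continuousOn.mul (Real.continuous_sin.comp_continuousOn hθc)).mul
      (Real.continuous_cos.comp_continuousOn hθc)
  obtain ⟨r, hr0, -, hr⟩ := exists_pos_hasDerivAt_mul_self hαβ hc
  refine ⟨r, hr0, fun x hx => ?_, fun x hx => ?_⟩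
  · convert! (hr x hx).mul (hθ x hx).sin using 1
    have := Real.sin_sq_add_cos_sq (θ x)
    simp only [angleField]
    linear_combination - P x * r x * Real.cos (θ x) * this
  · convert! (hr x hx).mul (hθ x hx).cos using 1
    have := Real.sin_sq_add_cos_sq (θ x)
    simp only [angleField]
    linear_combination Q x * r x * Real.sin (θ x) * this

/-- A solution vanishing at the left endpoint is a multiple of a given real one. -/
lemma IsSolution.exists_eq_const_mul {α β : ℝ} {P ρ : ℝ → ℝ} {μ : ℝ} {v J : ℝ → ℂ}
    (h : IsSolution α β P ρ ((-μ : ℝ) : ℂ) v J) (hα : v α = 0) {V N : ℝ → ℝ}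
    (hV : ∀ x ∈ Icc α β, HasDerivAt V (P x * N x) x)
    (hN : ∀ x ∈ Icc α β, HasDerivAt N (-(μ * ρ x) * V x) x)
    (hVα : V α = 0) (hpos : ∀ x, 0 < V x ^ 2 + N x ^ 2) :
    ∃ k : ℂ, ∀ x ∈ Icc α β, v x = k * V x := by
  have cV : ContinuousOn (fun x => (V x : ℂ)) (Icc α β) := fun x hx =>
    (hV x hx).ofReal_comp.continuousAt.continuousWithinAt
  have cN : ContinuousOn (fun x => (N x : ℂ)) (Icc α β) := fun x hx =>
    (hN x hx).ofReal_comp.continuousAt.continuousWithinAt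
  have hne : ∀ x, (V x : ℂ) ^ 2 + (N x : ℂ) ^ 2 ≠ 0 := fun x => by
    exact_mod_cast (hpos x).ne'
  -- The Wronskian is constant and vanishes at α.
  have hw : ∀ x ∈ Icc α β, v x * N x - J x * V x = 0 := by
    intro x hx
    have := eq_left_of_hasDerivAt_zero (f := fun x => v x * N x - J x * V x)
      ((h.continuousOn_v.mul cN).sub (h.continuousOn_J.mul cV)) (fun y hy => ?_) x hx
    · simpa [hα, hVα] using this
    · have hy' := Ioo_subset_Icc_self hy
      convert! ((h.hasDerivAt_v y hy).mul (hN y hy').ofReal_comp).sub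
        ((h.hasDerivAt_J y hy).mul (hV y hy').ofReal_comp) using 1
      push_cast
      ring
  -- The component of (v, J) along (V, N) is constant because the numerator of its derivative is a
  -- multiple of the Wronskian.
  have hk : ∀ x ∈ Icc α β, (v x * V x + J x * N x) / ((V x : ℂ) ^ 2 + (N x : ℂ) ^ 2) =
      (v α * V α + J α * N α) / ((V α : ℂ) ^ 2 + (N α : ℂ) ^ 2) := by
    refine eq_left_of_hasDerivAt_zero
      (f := fun x => (v x * V x + J x * N x) / ((V x : ℂ) ^ 2 + (N x : ℂ) ^ 2)) ?_ fun y hy => ?_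
    · exact ((h.continuousOn_v.mul cV).add (h.continuousOn_J.mul cN)).div
        ((cV.pow 2).add (cN.pow 2)) fun x _ => hne x
    · have hy' := Ioo_subset_Icc_self hy
      have dV := (hV y hy').ofReal_comp
      have dN := (hN y hy').ofReal_comp
      convert! (((h.hasDerivAt_v y hy).mul dV).add ((h.hasDerivAt_J y hy).mul dN)).div
        ((dV.pow 2).add (dN.pow 2)) (hne y) using 1
      have hwy := hw y hy'
      symm
      rw [div_eq_zero_iff]
      left
      simp only [Pi.add_apply, Pi.mul_apply, Pi.pow_apply]
      push_cast
      linear_combination ((P y : ℂ) - μ * ρ y) * ((N y : ℂ) ^ 2 - (V y : ℂ) ^ 2) * hwy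
  refine ⟨(v α * V α + J α * N α) / ((V α : ℂ) ^ 2 + (N α : ℂ) ^ 2), fun x hx => ?_⟩
  rw [← hk x hx, div_mul_eq_mul_div, eq_div_iff (hne x)]
  linear_combination (N x : ℂ) * hw x hx

/-- A positive strict supersolution on an interval bounds from below the parameter of a nonnegative
solution vanishing at both endpoints. -/
lemma le_of_supersolution {α β : ℝ} (hαβ : α ≤ β) {P ρ v J φ Ψ Ψ' : ℝ → ℝ} {μ κ : ℝ}
    (hvc : ContinuousOn v (Icc α β)) (hJc : ContinuousOn J (Icc α β))
    (hv : ∀ x ∈ Ioo α β, HasDerivAt v (P x * J x) x)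
    (hJ : ∀ x ∈ Ioo α β, HasDerivAt J (-(μ * ρ x) * v x) x)
    (hφc : ContinuousOn φ (Icc α β)) (hΨc : ContinuousOn Ψ (Icc α β))
    (hφ : ∀ x ∈ Ioo α β, HasDerivAt φ (P x * Ψ x) x)
    (hΨ : ∀ x ∈ Ioo α β, HasDerivAt Ψ (Ψ' x) x)
    (hφ0 : ∀ x, 0 < φ x) (hρ0 : ∀ x, 0 < ρ x)
    (hsup : ∀ x ∈ Ioo α β, Ψ' x ≤ -κ * ρ x * φ x)
    (hv0 : ∀ x ∈ Ioo α β, 0 ≤ v x) (hvα : v α = 0) (hvβ : v β = 0) (hJα : 0 < J α)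
    (hJβ : J β < 0) : κ ≤ μ := by
  by_contra! hlt
  -- If μ < κ, the Wronskian φ J - v Ψ is nondecreasing; but it equals φ J at both ends, positive at
  -- α and negative at β.
  have hm := monotoneOn_Icc_of_hasDerivAt_nonneg (f := fun x => φ x * J x - v x * Ψ x)
    (f' := fun x => v x * (-(φ x * (μ * ρ x)) - Ψ' x))
    ((hφc.mul hJc).sub (hvc.mul hΨc)) (fun x hx => by
      convert! ((hφ x hx).mul (hJ x hx)).sub ((hv x hx).mul (hΨ x hx)) using 1
      ring) (fun x hx => by
      refine mul_nonneg (hv0 x hx) ?_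
      have h1 := hsup x hx
      have h2 : 0 ≤ (κ - μ) * (ρ x * φ x) :=
        mul_nonneg (sub_pos.2 hlt).le (mul_pos (hρ0 x) (hφ0 x)).le
      nlinarith)
    (left_mem_Icc.2 hαβ) (right_mem_Icc.2 hαβ) hαβ
  simp only [hvα, hvβ, zero_mul, sub_zero] at hm
  have := mul_pos (hφ0 α) hJα
  have := mul_neg_of_pos_of_neg (hφ0 β) hJβ
  linarith

/-! ### Eigenfunctions versus solutions of the system -/

/-- A primitive of a function continuous on `[α, β]` is differentiable inside. -/
lemma hasDerivAt_of_eq_add_integral {α β : ℝ} (hαβ : α ≤ β) {f F : ℝ → ℂ}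
    (hf : ContinuousOn f (Icc α β)) (hF : ∀ x ∈ Icc α β, F x = F α + ∫ t in α..x, f t) :
    ContinuousOn F (Icc α β) ∧ ∀ x ∈ Ioo α β, HasDerivAt F (f x) x := by
  set f' : ℝ → ℂ := IccExtend hαβ ((Icc α β).domRestrict f) with hf'
  have hcont : Continuous f' := (continuousOn_iff_continuous_domRestrict.1 hf).Icc_extend'
  have hff' : ∀ x ∈ Icc α β, f' x = f x := fun x hx => by
    rw [hf', IccExtend_of_mem _ _ hx]; rfl
  have hd : ∀ x, HasDerivAt (fun x => F α + ∫ t in α..x, f' t) (f' x) x := fun x =>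
    ((hcont.integral_hasStrictDerivAt α x).hasDerivAt).const_add _
  have heq : EqOn F (fun x => F α + ∫ t in α..x, f' t) (Icc α β) := by
    intro x hx
    rw [hF x hx]
    congr 1
    refine intervalIntegral.integral_congr fun t ht => (hff' t ?_).symm
    rw [uIcc_of_le hx.1] at ht
    exact ⟨ht.1, ht.2.trans hx.2⟩
  refine ⟨ContinuousOn.congr (fun x _ => (hd x).continuousAt.continuousWithinAt) heq,
    fun x hx => ?_⟩
  rw [← hff' x (Ioo_subset_Icc_self hx)]
  exact (hd x).congr_of_eventuallyEq (heq.eventuallyEq_of_mem (Icc_mem_nhds hx.1 hx.2))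

/-- An eigenfunction `u` gives rise to the solution `(u / ρ, ε u' - a u)` of the first order
system. -/
lemma IsEigenfunction.exists_isSolution {ℓ ξ ε : ℝ} (hℓ : 0 < ℓ) (hε : 0 < ε) {a b ρ : ℝ → ℝ}
    (hb : Continuous b) (hab : EqOn b a (Icc (-ℓ) ℓ))
    (ha : ∀ x ∈ Ioo (-ℓ) ℓ, x ≠ ξ → DifferentiableAt ℝ a x)
    (hρ0 : ∀ x, 0 < ρ x) (hρ : ∀ x, HasDerivAt ρ (ρ x * b x / ε) x) {lam : ℂ} {u : ℝ → ℂ}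
    (hu : IsEigenfunction ℓ ε a lam u) :
    ∃ J : ℝ → ℂ, IsSolution (-ℓ) ℓ (fun x => (ε * ρ x)⁻¹) ρ lam (fun x => u x / ρ x) J ∧
      u (-ℓ) = 0 ∧ u ℓ = 0 ∧ ∃ x ∈ Icc (-ℓ) ℓ, u x ≠ 0 := by
  obtain ⟨⟨du, d2u, hH, heq⟩, hne⟩ := hu
  have hle : -ℓ ≤ ℓ := by linarith
  have hintegrable : IntegrableOn d2u (Icc (-ℓ) ℓ) := by
    rw [integrableOn_Icc_iff_integrableOn_Ioo]
    exact hH.memLp.integrable (by norm_num)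
  have hduc : ContinuousOn du (Icc (-ℓ) ℓ) := by
    have := intervalIntegral.continuousOn_primitive_interval (μ := volume) (f := d2u)
      (a := -ℓ) (b := ℓ) (by rwa [uIcc_of_le hle])
    rw [uIcc_of_le hle] at this
    exact (continuousOn_const.add this).congr hH.du_eq
  have hu0 : u (-ℓ) = 0 := by simpa using hH.u_eq (-ℓ) (left_mem_Icc.2 hle)
  obtain ⟨huc, hud⟩ := hasDerivAt_of_eq_add_integral hle hduc (F := u)
    (fun x hx => by rw [hu0, zero_add]; exact hH.u_eq x hx)
  have hρc : Continuous ρ := continuous_iff_continuousAt.2 fun x => (hρ x).continuousAt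
  set J : ℝ → ℂ := fun x => ε * du x - b x * u x with hJ
  set D : ℝ → ℂ := fun x => deriv (fun y => (a y : ℂ) * u y) x with hD
  have hDd : ∀ x ∈ Ioo (-ℓ) ℓ \ {ξ}, HasDerivAt (fun y => (a y : ℂ) * u y) (D x) x := by
    intro x hx
    exact ((ha x hx.1 hx.2).hasDerivAt.ofReal_comp.mul (hud x hx.1)).differentiableAt.hasDerivAt
  have hac : ContinuousOn (fun y => (a y : ℂ) * u y) (Icc (-ℓ) ℓ) := by
    refine ContinuousOn.mul ?_ huc
    exact Complex.continuous_ofReal.comp_continuousOn (hb.continuousOn.congr hab.symm)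
  have hui : IntegrableOn u (Icc (-ℓ) ℓ) := huc.integrableOn_Icc
  have heq' : D =ᵐ[volume.restrict (Icc (-ℓ) ℓ)] fun x => ε * d2u x - lam * u x := by
    rw [← restrict_Ioo_eq_restrict_Icc]
    filter_upwards [heq] with x hx
    rw [← hx]; ring
  have hDi : IntegrableOn D (Icc (-ℓ) ℓ) :=
    ((hintegrable.const_mul (ε : ℂ)).sub (hui.const_mul lam)).congr heq'.symm
  -- The product a u is continuous and differentiable off ξ, so the fundamental theorem of calculus
  -- applies across ξ. The corner of a cancels in the flux, which thus has the continuous derivative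
  -- λ u.
  have hJint : ∀ x ∈ Icc (-ℓ) ℓ, J x = J (-ℓ) + ∫ t in (-ℓ)..x, lam * u t := by
    intro x hx
    have hsub : Icc (-ℓ) x ⊆ Icc (-ℓ) ℓ := Icc_subset_Icc_right hx.2
    have hII : ∀ {g : ℝ → ℂ}, IntegrableOn g (Icc (-ℓ) ℓ) →
        IntervalIntegrable g volume (-ℓ) x := fun hg =>
      (intervalIntegrable_iff_integrableOn_Icc_of_le hx.1).2 (hg.mono_set hsub)
    have hftc := integral_eq_of_hasDerivAt_off_countable_of_le _ D hx.1 (countable_singleton ξ)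
      (hac.mono hsub) (fun y hy => hDd y ⟨⟨hy.1.1, hy.1.2.trans_le hx.2⟩, hy.2⟩) (hII hDi)
    have hcongr : ∫ t in (-ℓ)..x, D t = ∫ t in (-ℓ)..x, (ε * d2u t - lam * u t) := by
      refine intervalIntegral.integral_congr_ae_restrict ?_
      rw [uIoc_of_le hx.1]
      exact ae_restrict_of_ae_restrict_of_subset (Ioc_subset_Icc_self.trans hsub) heq'
    rw [hcongr, intervalIntegral.integral_sub ((hII hintegrable).const_mul _) ((hII hui).const_mul _),
      intervalIntegral.integral_const_mul] at hftc
    have h1 := hH.du_eq x hx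
    simp only [hJ, hu0, hab hx] at hftc ⊢
    rw [h1]
    linear_combination hftc
  obtain ⟨hJc, hJd⟩ := hasDerivAt_of_eq_add_integral hle (continuousOn_const.mul huc) hJint
  have hρne : ∀ x, (ρ x : ℂ) ≠ 0 := fun x => by exact_mod_cast (hρ0 x).ne'
  have hεne : (ε : ℂ) ≠ 0 := by exact_mod_cast hε.ne'
  refine ⟨J, ⟨?_, hJc, fun x hx => ?_, fun x hx => ?_⟩, hu0, hH.u_right, hne⟩
  · exact huc.div (Complex.continuous_ofReal.comp hρc).continuousOn fun x _ => hρne x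
  · convert! (hud x hx).div (hρ x).ofReal_comp (hρne x) using 1
    have := hρne x
    simp only [hJ]
    push_cast
    field_simp
  · convert! hJd x hx using 1
    rw [mul_assoc, mul_div_cancel₀ _ (hρne x)]
    rfl

/-- A real solution of the first order system vanishing at both endpoints gives rise to an
eigenfunction. -/
lemma isEigenfunction_of_solution {ℓ ξ ε : ℝ} (hℓ : 0 < ℓ) (hε : 0 < ε) {a b ρ : ℝ → ℝ}
    (hb : Continuous b) (hab : EqOn b a (Icc (-ℓ) ℓ))
    (ha : ∀ x ∈ Ioo (-ℓ) ℓ, x ≠ ξ → DifferentiableAt ℝ a x)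
    {B : ℝ} (hB : ∀ x ∈ Ioo (-ℓ) ℓ, x ≠ ξ → |deriv a x| ≤ B)
    (hρ0 : ∀ x, 0 < ρ x) (hρ : ∀ x, HasDerivAt ρ (ρ x * b x / ε) x) {μ : ℝ} {V N : ℝ → ℝ}
    (hV : ∀ x ∈ Icc (-ℓ) ℓ, HasDerivAt V ((ε * ρ x)⁻¹ * N x) x)
    (hN : ∀ x ∈ Icc (-ℓ) ℓ, HasDerivAt N (-(μ * ρ x) * V x) x)
    (hV0 : V (-ℓ) = 0) (hVℓ : V ℓ = 0) (hne : ∃ x ∈ Icc (-ℓ) ℓ, V x ≠ 0) :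
    IsEigenfunction ℓ ε a ((-μ : ℝ) : ℂ) (fun x => ((ρ x * V x : ℝ) : ℂ)) := by
  have hle : -ℓ ≤ ℓ := by linarith
  set U : ℝ → ℝ := fun x => ρ x * V x with hU
  set U' : ℝ → ℝ := fun x => (b x * U x + N x) / ε with hU'
  -- Obtained by differentiating ε U' = b U + N off ξ, where N' = -μ U.
  set U'' : ℝ → ℝ := fun x => (deriv a x * U x + b x * U' x - μ * U x) / ε with hU''
  have hUd : ∀ x ∈ Icc (-ℓ) ℓ, HasDerivAt U (U' x) x := by
    intro x hx
    convert! (hρ x).mul (hV x hx) using 1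
    have := (hρ0 x).ne'
    simp only [hU', hU]
    field_simp
  have hUc : ContinuousOn U (Icc (-ℓ) ℓ) := fun x hx =>
    (hUd x hx).continuousAt.continuousWithinAt
  have hU'c : ContinuousOn U' (Icc (-ℓ) ℓ) :=
    ((hb.continuousOn.mul hUc).add fun x hx =>
      (hN x hx).continuousAt.continuousWithinAt).div_const _
  have hU'd : ∀ x ∈ Ioo (-ℓ) ℓ \ {ξ}, HasDerivAt U' (U'' x) x := by
    intro x hx
    have hx' := Ioo_subset_Icc_self hx.1
    have hbd : HasDerivAt b (deriv a x) x := (ha x hx.1 hx.2).hasDerivAt.congr_of_eventuallyEq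
      (hab.eventuallyEq_of_mem (Icc_mem_nhds hx.1.1 hx.1.2))
    convert! ((hbd.mul (hUd x hx')).add (hN x hx')).div_const ε using 1
    simp only [hU'', hU]
    ring
  have hoff : ∀ᵐ x ∂(volume.restrict (Ioo (-ℓ) ℓ)), x ∈ Ioo (-ℓ) ℓ ∧ x ≠ ξ := by
    filter_upwards [ae_restrict_mem measurableSet_Ioo,
      ae_restrict_of_ae ((countable_singleton ξ).ae_notMem volume)] with x h1 h2 using ⟨h1, h2⟩
  -- The bound on a' makes U'' bounded, hence square integrable.
  have hmemR : MemLp U'' 2 (volume.restrict (Ioo (-ℓ) ℓ)) := by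
    have hg : ContinuousOn (fun x => b x * U' x - μ * U x) (Icc (-ℓ) ℓ) :=
      (hb.continuousOn.mul hU'c).sub (continuousOn_const.mul hUc)
    obtain ⟨C₁, hC₁⟩ := isCompact_Icc.exists_bound_of_continuousOn hUc
    obtain ⟨C₂, hC₂⟩ := isCompact_Icc.exists_bound_of_continuousOn hg
    refine MemLp.of_bound (C := (B * C₁ + C₂) / ε) ?_ ?_
    · have m1 : AEStronglyMeasurable U (volume.restrict (Ioo (-ℓ) ℓ)) :=
        (hUc.mono Ioo_subset_Icc_self).aestronglyMeasurable measurableSet_Ioo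
      have m2 : AEStronglyMeasurable (fun x => b x * U' x - μ * U x)
          (volume.restrict (Ioo (-ℓ) ℓ)) :=
        (hg.mono Ioo_subset_Icc_self).aestronglyMeasurable measurableSet_Ioo
      have m3 : AEStronglyMeasurable (deriv a) (volume.restrict (Ioo (-ℓ) ℓ)) :=
        (measurable_deriv a).aestronglyMeasurable
      refine (((m3.mul m1).add m2).const_mul ε⁻¹).congr (Eventually.of_forall fun x => ?_)
      simp only [hU'', Pi.add_apply, Pi.mul_apply]
      ring
    · filter_upwards [hoff] with x hx
      have hx' := Ioo_subset_Icc_self hx.1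
      have e : U'' x = (deriv a x * U x + (b x * U' x - μ * U x)) / ε := by
        simp only [hU'']; ring
      rw [e, norm_div, Real.norm_of_nonneg hε.le]
      have h1 := hC₁ x hx'
      have h2 := hC₂ x hx'
      have h3 : ‖deriv a x‖ ≤ B := hB x hx.1 hx.2
      have hB0 : 0 ≤ B := (norm_nonneg _).trans h3
      gcongr
      refine (norm_add_le _ _).trans (add_le_add ?_ h2)
      rw [norm_mul]
      gcongr
  have hmem : MemLp (fun x => (U'' x : ℂ)) 2 (volume.restrict (Ioo (-ℓ) ℓ)) := hmemR.ofReal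
  have hintegrable : IntegrableOn (fun x => (U'' x : ℂ)) (Icc (-ℓ) ℓ) := by
    rw [integrableOn_Icc_iff_integrableOn_Ioo]
    exact hmem.integrable (by norm_num)
  have hII : ∀ {g : ℝ → ℂ} {x : ℝ}, x ∈ Icc (-ℓ) ℓ → IntegrableOn g (Icc (-ℓ) ℓ) →
      IntervalIntegrable g volume (-ℓ) x := fun hx hg =>
    (intervalIntegrable_iff_integrableOn_Icc_of_le hx.1).2
      (hg.mono_set (Icc_subset_Icc_right hx.2))
  have hU'C : ContinuousOn (fun x => (U' x : ℂ)) (Icc (-ℓ) ℓ) :=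
    Complex.continuous_ofReal.comp_continuousOn hU'c
  have hUC : ContinuousOn (fun x => (U x : ℂ)) (Icc (-ℓ) ℓ) :=
    Complex.continuous_ofReal.comp_continuousOn hUc
  refine ⟨⟨fun x => (U' x : ℂ), fun x => (U'' x : ℂ), ⟨hmem, ?_, ?_, ?_⟩, ?_⟩, ?_⟩
  · intro x hx
    have := integral_eq_of_hasDerivAt_off_countable_of_le _ (fun x => (U'' x : ℂ)) hx.1
      (countable_singleton ξ) (hU'C.mono (Icc_subset_Icc_right hx.2))
      (fun y hy => (hU'd y ⟨⟨hy.1.1, hy.1.2.trans_le hx.2⟩, hy.2⟩).ofReal_comp) (hII hx hintegrable)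
    rw [this]; ring
  · intro x hx
    have := integral_eq_of_hasDerivAt_off_countable_of_le _ (fun x => (U' x : ℂ)) hx.1
      countable_empty (hUC.mono (Icc_subset_Icc_right hx.2))
      (fun y hy => (hUd y ⟨hy.1.1.le, hy.1.2.le.trans hx.2⟩).ofReal_comp)
      (hII hx hU'C.integrableOn_Icc)
    rw [this]
    simp [hU, hV0]
  · simp [hVℓ]
  · filter_upwards [hoff] with x hx
    have hx' := Ioo_subset_Icc_self hx.1
    have hd₁ : HasDerivAt (fun y => (a y : ℂ)) ((deriv a x : ℝ) : ℂ) x :=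
      (ha x hx.1 hx.2).hasDerivAt.ofReal_comp
    have hd₂ : HasDerivAt (fun y => (U y : ℂ)) ((U' x : ℝ) : ℂ) x := (hUd x hx').ofReal_comp
    rw [(hd₁.fun_mul hd₂).deriv]
    have hεne : (ε : ℂ) ≠ 0 := by exact_mod_cast hε.ne'
    simp only [hU'', hU, hab hx']
    push_cast
    field_simp
    ring
  · obtain ⟨x, hx, hVx⟩ := hne
    exact ⟨x, hx, Complex.ofReal_ne_zero.2 (mul_ne_zero (hρ0 x).ne' hVx)⟩

/-! ### Boundedness of the derivative of the coefficient -/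

lemma derivWithin_Iic_le_deriv {α ξ : ℝ} {a : ℝ → ℝ} (hc : ContinuousOn a (Ioc α ξ))
    (hd : ∀ x ∈ Ioo α ξ, DifferentiableAt ℝ a x)
    (hd2 : ∀ x ∈ Ioo α ξ, DifferentiableAt ℝ (deriv a) x)
    (hneg : ∀ x ∈ Ioo α ξ, deriv (deriv a) x < 0)
    (hξ : DifferentiableWithinAt ℝ a (Iic ξ) ξ) {x : ℝ} (hx : x ∈ Ioo α ξ) :
    derivWithin a (Iic ξ) ξ ≤ deriv a x := by
  have hanti : StrictAntiOn (deriv a) (Ioo α ξ) :=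
    strictAntiOn_of_deriv_neg (convex_Ioo α ξ)
      (fun y hy => (hd2 y hy).continuousAt.continuousWithinAt)
      (fun y hy => hneg y (interior_subset hy))
  have hlim := (hasDerivWithinAt_iff_tendsto_slope' self_notMem_Iio).1
    (hξ.hasDerivWithinAt.mono Iio_subset_Iic_self)
  -- For y in (x, ξ) the slope of the chord over [y, ξ] is a'(z) with z > x, hence at most a'(x) by
  -- concavity.
  refine le_of_tendsto hlim ?_
  filter_upwards [Ioo_mem_nhdsLT hx.2] with y hy
  obtain ⟨z, hz, hzs⟩ := exists_deriv_eq_slope a hy.2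
    (hc.mono fun t ht => ⟨hx.1.trans (hy.1.trans_le ht.1), ht.2⟩)
    (fun t ht => (hd t ⟨hx.1.trans (hy.1.trans ht.1), ht.2⟩).differentiableWithinAt)
  rw [slope_comm, slope_def_field, ← hzs]
  exact (hanti hx ⟨hx.1.trans (hy.1.trans hz.1), hz.2⟩ (hy.1.trans hz.1)).le

lemma derivWithin_Ici_le_deriv {β ξ : ℝ} {a : ℝ → ℝ} (hc : ContinuousOn a (Ico ξ β))
    (hd : ∀ x ∈ Ioo ξ β, DifferentiableAt ℝ a x)
    (hd2 : ∀ x ∈ Ioo ξ β, DifferentiableAt ℝ (deriv a) x)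
    (hpos : ∀ x ∈ Ioo ξ β, 0 < deriv (deriv a) x)
    (hξ : DifferentiableWithinAt ℝ a (Ici ξ) ξ) {x : ℝ} (hx : x ∈ Ioo ξ β) :
    derivWithin a (Ici ξ) ξ ≤ deriv a x := by
  have hmono : StrictMonoOn (deriv a) (Ioo ξ β) :=
    strictMonoOn_of_deriv_pos (convex_Ioo ξ β)
      (fun y hy => (hd2 y hy).continuousAt.continuousWithinAt)
      (fun y hy => hpos y (interior_subset hy))
  have hlim := (hasDerivWithinAt_iff_tendsto_slope' self_notMem_Ioi).1
    (hξ.hasDerivWithinAt.mono Ioi_subset_Ici_self)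
  refine le_of_tendsto hlim ?_
  filter_upwards [Ioo_mem_nhdsGT hx.1] with y hy
  obtain ⟨z, hz, hzs⟩ := exists_deriv_eq_slope a hy.1
    (hc.mono fun t ht => ⟨ht.1, ht.2.trans_lt (hy.2.trans hx.2)⟩)
    (fun t ht => (hd t ⟨ht.1, ht.2.trans (hy.2.trans hx.2)⟩).differentiableWithinAt)
  rw [slope_def_field, ← hzs]
  exact (hmono ⟨hz.1, hz.2.trans (hy.2.trans hx.2)⟩ hx (hz.2.trans hy.2)).le

/-- The derivative of a coefficient satisfying A1, with one-sided derivatives at `ξ`, is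
bounded. -/
lemma HypA1.exists_abs_deriv_le {ℓ ξ : ℝ} {a : ℝ → ℝ} (h : HypA1 ℓ ξ a)
    (hξ : ξ ∈ Ioo (-ℓ) ℓ) (hc : ContinuousOn a (Icc (-ℓ) ℓ))
    (hl : DifferentiableWithinAt ℝ a (Iic ξ) ξ) (hr : DifferentiableWithinAt ℝ a (Ici ξ) ξ) :
    ∃ B, ∀ x ∈ Ioo (-ℓ) ℓ, x ≠ ξ → |deriv a x| ≤ B := by
  refine ⟨max (-derivWithin a (Iic ξ) ξ) (-derivWithin a (Ici ξ) ξ), fun x hx hne => ?_⟩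
  rcases lt_or_gt_of_ne hne with hlt | hgt
  · have hsub : ∀ y ∈ Ioo (-ℓ) ξ, y ∈ Ioo (-ℓ) ℓ := fun y hy => ⟨hy.1, hy.2.trans hξ.2⟩
    have := derivWithin_Iic_le_deriv
      (hc.mono fun y hy => ⟨hy.1.le, hy.2.trans hξ.2.le⟩)
      (fun y hy => h.differentiable y (hsub y hy) hy.2.ne)
      (fun y hy => h.twice_differentiable y (hsub y hy) hy.2.ne)
      (fun y hy => (h.left y hy).2.1) hl ⟨hx.1, hlt⟩
    rw [abs_of_neg (h.left x ⟨hx.1, hlt⟩).1]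
    exact (neg_le_neg this).trans (le_max_left _ _)
  · have hsub : ∀ y ∈ Ioo ξ ℓ, y ∈ Ioo (-ℓ) ℓ := fun y hy => ⟨hξ.1.trans hy.1, hy.2⟩
    have := derivWithin_Ici_le_deriv
      (hc.mono fun y hy => ⟨hξ.1.le.trans hy.1, hy.2.le⟩)
      (fun y hy => h.differentiable y (hsub y hy) hy.1.ne')
      (fun y hy => h.twice_differentiable y (hsub y hy) hy.1.ne')
      (fun y hy => (h.right y hy).2.2) hr ⟨hgt, hx.2⟩
    rw [abs_of_neg (h.right x ⟨hgt, hx.2⟩).2.1]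
    exact (neg_le_neg this).trans (le_max_right _ _)

/-! ### The explicit supersolution -/

/-- The Riccati form of `le_of_supersolution`: the supersolution is `exp G`, with `G' = h`. -/
lemma le_of_log_supersolution {α β ε : ℝ} (hαβ : α ≤ β) (hε : 0 < ε) {b ρ v J G h h' : ℝ → ℝ}
    {μ κ : ℝ} (hρ0 : ∀ x, 0 < ρ x) (hρ : ∀ x, HasDerivAt ρ (ρ x * b x / ε) x)
    (hv : ∀ x ∈ Icc α β, HasDerivAt v ((ε * ρ x)⁻¹ * J x) x)
    (hJ : ∀ x ∈ Icc α β, HasDerivAt J (-(μ * ρ x) * v x) x)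
    (hG : ∀ x, HasDerivAt G (h x) x) (hh : ∀ x, HasDerivAt h (h' x) x)
    (hric : ∀ x ∈ Ioo α β, b x * h x + ε * h' x + ε * h x ^ 2 ≤ -κ)
    (hv0 : ∀ x ∈ Ioo α β, 0 ≤ v x) (hvα : v α = 0) (hvβ : v β = 0) (hJα : 0 < J α)
    (hJβ : J β < 0) : κ ≤ μ := by
  have hφ : ∀ x, HasDerivAt (fun x => Real.exp (G x))
      ((ε * ρ x)⁻¹ * (ε * (ρ x * h x * Real.exp (G x)))) x := fun x => by
    convert! (hG x).exp using 1
    have := (hρ0 x).ne'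
    field_simp
  have hΨ : ∀ x, HasDerivAt (fun x => ε * (ρ x * h x * Real.exp (G x)))
      ((b x * h x + ε * h' x + ε * h x ^ 2) * (ρ x * Real.exp (G x))) x := fun x => by
    convert! ((((hρ x).mul (hh x)).mul (hG x).exp).const_mul ε) using 1
    simp only [Pi.mul_apply]
    field_simp
  refine le_of_supersolution hαβ (P := fun x => (ε * ρ x)⁻¹) (ρ := ρ)
    (fun x hx => (hv x hx).continuousAt.continuousWithinAt)
    (fun x hx => (hJ x hx).continuousAt.continuousWithinAt)
    (fun x hx => hv x (Ioo_subset_Icc_self hx)) (fun x hx => hJ x (Ioo_subset_Icc_self hx))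
    (fun x _ => (hφ x).continuousAt.continuousWithinAt)
    (fun x _ => (hΨ x).continuousAt.continuousWithinAt) (fun x _ => hφ x) (fun x _ => hΨ x)
    (fun x => Real.exp_pos _) hρ0 (fun x hx => ?_) hv0 hvα hvβ hJα hJβ
  rw [mul_assoc]
  exact mul_le_mul_of_nonneg_right (hric x hx) (mul_pos (hρ0 x) (Real.exp_pos _)).le

/-- Here g = δ (1 + e^s) lies in [δ, 2δ]. For s ≤ -c the drift term -t g ≤ -m g absorbs g², since g
≤ m/2. For s ≥ -c the term -δ e^s ≤ -δ e^{-c} absorbs g² ≤ 4δ². -/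
lemma riccati_le {δ m c s t : ℝ} (hδ : 0 < δ) (hδc : 8 * δ ≤ Real.exp (-c)) (hδm : 4 * δ ≤ m)
    (hs : s ≤ 0) (ht : 0 ≤ t) (hmt : s ≤ -c → m ≤ t) :
    -t * (δ * (1 + Real.exp s)) - δ * Real.exp s + (δ * (1 + Real.exp s)) ^ 2 ≤
      -(δ * min (Real.exp (-c)) m / 2) := by
  have he0 := Real.exp_pos s
  have he1 : Real.exp s ≤ 1 := Real.exp_le_one_iff.2 hs
  have hg0 : 0 < δ * (1 + Real.exp s) := by positivity
  have hgδ : δ ≤ δ * (1 + Real.exp s) := by nlinarith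
  have hg2 : δ * (1 + Real.exp s) ≤ 2 * δ := by nlinarith
  set g := δ * (1 + Real.exp s)
  rcases le_total s (-c) with hsc | hsc
  · have h1 : δ * min (Real.exp (-c)) m ≤ δ * m := by gcongr; exact min_le_right _ _
    have h2 : m * g ≤ t * g := by gcongr; exact hmt hsc
    have h3 : 0 < δ * Real.exp s := by positivity
    nlinarith
  · have h1 : δ * min (Real.exp (-c)) m ≤ δ * Real.exp (-c) := by gcongr; exact min_le_left _ _
    have h2 : δ * Real.exp (-c) ≤ δ * Real.exp s := by gcongr
    have h3 : 0 ≤ t * g := by positivity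
    nlinarith

/-- Lower bound for the Dirichlet parameter on an interval lying on one side of `ξ`, where the
drift points towards `ξ`, and does so at speed at least `m` away from `ξ`. -/
lemma le_of_drift_towards {α β ε ξ σ δ m c : ℝ} (hαβ : α ≤ β) (hε : 0 < ε) (hσ : σ ^ 2 = 1)
    (hδ : 0 < δ) (hδc : 8 * δ ≤ Real.exp (-c)) (hδm : 4 * δ ≤ m)
    {b ρ v J : ℝ → ℝ} {μ : ℝ} (hρ0 : ∀ x, 0 < ρ x)
    (hρ : ∀ x, HasDerivAt ρ (ρ x * b x / ε) x)
    (hv : ∀ x ∈ Icc α β, HasDerivAt v ((ε * ρ x)⁻¹ * J x) x)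
    (hJ : ∀ x ∈ Icc α β, HasDerivAt J (-(μ * ρ x) * v x) x)
    (hside : ∀ x ∈ Ioo α β, σ * (x - ξ) ≤ 0) (hb : ∀ x ∈ Ioo α β, 0 ≤ σ * b x)
    (hbm : ∀ x ∈ Ioo α β, σ * (x - ξ) ≤ -(c * ε) → m ≤ σ * b x)
    (hv0 : ∀ x ∈ Ioo α β, 0 ≤ v x) (hvα : v α = 0) (hvβ : v β = 0) (hJα : 0 < J α)
    (hJβ : J β < 0) : (δ * min (Real.exp (-c)) m / 2) / ε ≤ μ := by
  have hs : ∀ x, HasDerivAt (fun x => σ * (x - ξ) / ε) (σ / ε) x := fun x => by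
    simpa using (((hasDerivAt_id x).sub_const ξ).const_mul σ).div_const ε
  refine le_of_log_supersolution hαβ hε hρ0 hρ hv hJ
    -- G = -δ (s + e^s) with s = σ (x - ξ) / ε: the linear part exploits the drift, the exponential
    -- part adds concavity near ξ, and each term of the Riccati expression scales as 1 / ε.
    (G := fun x => -δ * (σ * (x - ξ) / ε + Real.exp (σ * (x - ξ) / ε)))
    (h := fun x => -δ * (σ / ε * (1 + Real.exp (σ * (x - ξ) / ε))))
    (h' := fun x => -δ * (σ / ε * (Real.exp (σ * (x - ξ) / ε) * (σ / ε))))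
    (fun x => ?_) (fun x => ?_) (fun x hx => ?_) hv0 hvα hvβ hJα hJβ
  · convert! ((hs x).add (hs x).exp).const_mul (-δ) using 1
    ring
  · exact (((hs x).exp.const_add 1).const_mul (σ / ε)).const_mul (-δ)
  · have key := riccati_le (s := σ * (x - ξ) / ε) (t := σ * b x) hδ hδc hδm
      (div_nonpos_of_nonpos_of_nonneg (hside x hx) hε.le) (hb x hx) (fun h => hbm x hx (by
        rw [div_le_iff₀ hε] at h; linarith))
    rw [← neg_div, le_div_iff₀ hε]
    refine le_trans (le_of_eq ?_) key
    field_simp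
    linear_combination (δ * (1 + Real.exp (σ * (x - ξ) / ε)) ^ 2
      - Real.exp (σ * (x - ξ) / ε)) * hσ

/-! ### Existence and nodal structure of the second eigenvalue -/

/-- The second eigenvalue exists; it is negative, and the associated solution of the first order
system has exactly one sign change. -/
lemma exists_isSecondEigenvalue {ℓ ξ ε : ℝ} (hℓ : 0 < ℓ) (hε : 0 < ε) {a b ρ : ℝ → ℝ}
    (hb : Continuous b) (hab : EqOn b a (Icc (-ℓ) ℓ))
    (ha : ∀ x ∈ Ioo (-ℓ) ℓ, x ≠ ξ → DifferentiableAt ℝ a x)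
    {B : ℝ} (hB : ∀ x ∈ Ioo (-ℓ) ℓ, x ≠ ξ → |deriv a x| ≤ B)
    (hρ0 : ∀ x, 0 < ρ x) (hρ : ∀ x, HasDerivAt ρ (ρ x * b x / ε) x) :
    ∃ (μ : ℝ) (V N : ℝ → ℝ) (z : ℝ), IsSecondEigenvalue ℓ ε a (-μ) ∧
      (∀ x ∈ Icc (-ℓ) ℓ, HasDerivAt V ((ε * ρ x)⁻¹ * N x) x) ∧
      (∀ x ∈ Icc (-ℓ) ℓ, HasDerivAt N (-(μ * ρ x) * V x) x) ∧
      z ∈ Icc (-ℓ) ℓ ∧ V (-ℓ) = 0 ∧ V z = 0 ∧ V ℓ = 0 ∧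
      0 < N (-ℓ) ∧ N z < 0 ∧ 0 < N ℓ ∧
      (∀ x ∈ Icc (-ℓ) z, 0 ≤ V x) ∧ ∀ x ∈ Icc z ℓ, V x ≤ 0 := by
  have hlt : -ℓ < ℓ := by linarith
  have hρc : Continuous ρ := continuous_iff_continuousAt.2 fun x => (hρ x).continuousAt
  set P : ℝ → ℝ := fun x => (ε * ρ x)⁻¹ with hPdef
  have hP0 : ∀ x, 0 < P x := fun x => inv_pos.2 (mul_pos hε (hρ0 x))
  have hP : Continuous P := (continuous_const.mul hρc).inv₀ fun x => (mul_pos hε (hρ0 x)).ne'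
  obtain ⟨θ, hθ⟩ := exists_isAngleFamily hlt.le hP hρc
  choose r hr0 hrV hrN using fun μ => exists_amplitude hlt.le (Q := fun x => μ * ρ x) hP
    (by fun_prop) (hθ.hasDerivAt μ)
  have hmono := hθ.strictMono_right hlt hP hρc hP0 hρ0
  have heig : ∀ μ, Real.sin (θ μ ℓ) = 0 → IsEigenvalue ℓ ε a ((-μ : ℝ) : ℂ) := by
    intro μ hμ
    refine ⟨_, isEigenfunction_of_solution hℓ hε hb hab ha hB hρ0 hρ (hrV μ) (hrN μ)
      (by simp [hθ.left]) (by simp [hμ]) ?_⟩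
    obtain ⟨x, hx, hs⟩ := hθ.exists_sin_ne_zero hlt hP0 μ
    exact ⟨x, Ioo_subset_Icc_self hx, mul_ne_zero (hr0 μ x).ne' hs⟩
  have hprop : ∀ (μ : ℝ) (u : ℝ → ℂ), IsEigenfunction ℓ ε a ((-μ : ℝ) : ℂ) u →
      ∃ k : ℂ, k ≠ 0 ∧ ∀ x ∈ Icc (-ℓ) ℓ,
        u x = k * ((ρ x * (r μ x * Real.sin (θ μ x)) : ℝ) : ℂ) := by
    intro μ u hu
    obtain ⟨J, hsol, hu0, -, y, hy, huy⟩ := hu.exists_isSolution hℓ hε hb hab ha hρ0 hρ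
    obtain ⟨k, hk⟩ := hsol.exists_eq_const_mul (by simp [hu0]) (hrV μ) (hrN μ)
      (by simp [hθ.left]) (fun x => by
        have h1 : (r μ x * Real.sin (θ μ x)) ^ 2 + (r μ x * Real.cos (θ μ x)) ^ 2
            = r μ x ^ 2 := by
          linear_combination r μ x ^ 2 * Real.sin_sq_add_cos_sq (θ μ x)
        rw [h1]
        exact pow_pos (hr0 μ x) 2)
    have hk' : ∀ x ∈ Icc (-ℓ) ℓ, u x = k * ((ρ x * (r μ x * Real.sin (θ μ x)) : ℝ) : ℂ) := by
      intro x hx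
      have hne : (ρ x : ℂ) ≠ 0 := Complex.ofReal_ne_zero.2 (hρ0 x).ne'
      have := hk x hx
      rw [div_eq_iff hne] at this
      rw [this]
      push_cast
      ring
    refine ⟨k, ?_, hk'⟩
    rintro rfl
    exact huy (by rw [hk' y hy, zero_mul])
  obtain ⟨μ₁, -, hθ₁⟩ := hθ.exists_right_eq hlt hP hρc hP0 hρ0
    (s := Real.pi) ⟨le_rfl, by linarith [Real.pi_pos]⟩
  obtain ⟨μ₂, hμ₂, hθ₂⟩ := hθ.exists_right_eq hlt hP hρc hP0 hρ0
    (s := 2 * Real.pi) ⟨by linarith [Real.pi_pos], le_rfl⟩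
  have h12 : μ₁ < μ₂ := by
    rw [← hmono.lt_iff_lt]
    simp only [hθ₁, hθ₂]
    linarith [Real.pi_pos]
  have hsecond : IsSecondEigenvalue ℓ ε a (-μ₂) := by
    refine ⟨heig μ₂ (by simp [hθ₂]), -μ₁, neg_lt_neg h12, heig μ₁ (by simp [hθ₁]), ?_, ?_⟩
    · intro u v hu hv
      obtain ⟨k, hk0, hk⟩ := hprop μ₁ u hu
      obtain ⟨k', -, hk'⟩ := hprop μ₁ v hv
      refine ⟨k' / k, fun x hx => ?_⟩
      rw [hk x hx, hk' x hx]
      field_simp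
    · rintro ν ⟨u, hu⟩
      obtain ⟨J, hsol, hu0, huℓ, y, hy, huy⟩ := hu.exists_isSolution hℓ hε hb hab ha hρ0 hρ
      have him : ν.im = 0 := hsol.im_eq_zero hρ0 (by simp [hu0]) (by simp [huℓ])
        ⟨y, hy, div_ne_zero huy (Complex.ofReal_ne_zero.2 (hρ0 y).ne')⟩
      have hν : ν = ((-(-ν.re) : ℝ) : ℂ) := by
        apply Complex.ext <;> simp [him]
      rw [hν] at hu
      obtain ⟨k, hk0, hk⟩ := hprop (-ν.re) u hu
      have hz := hk ℓ (right_mem_Icc.2 hlt.le)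
      rw [huℓ] at hz
      have hsin : Real.sin (θ (-ν.re) ℓ) = 0 := by
        have h1 := (mul_eq_zero.1 hz.symm).resolve_left hk0
        rw [Complex.ofReal_eq_zero] at h1
        have h2 := (mul_eq_zero.1 h1).resolve_left (hρ0 ℓ).ne'
        exact (mul_eq_zero.1 h2).resolve_left (hr0 _ ℓ).ne'
      -- The final angle is n π with n ≥ 1; by monotonicity n = 1 forces the parameter μ₁, and n ≥ 2
      -- a parameter at least μ₂.
      obtain ⟨n, hn⟩ := Real.sin_eq_zero_iff.1 hsin
      have hpos := hθ.pos_right hlt hP hρc hP0 (-ν.re)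
      rw [← hn] at hpos
      have hn0 : 0 < n := by
        have := (mul_pos_iff_of_pos_right Real.pi_pos).1 hpos
        exact_mod_cast this
      rcases (show n = 1 ∨ 2 ≤ n by omega) with rfl | hn2
      · left
        have : -ν.re = μ₁ := hmono.injective (by simp only [hθ₁, ← hn]; simp)
        rw [hν, this]
      · right
        refine ⟨him, ?_⟩
        have : μ₂ ≤ -ν.re := by
          rw [← hmono.le_iff_le]
          simp only [hθ₂, ← hn]
          have : (2 : ℝ) ≤ n := by exact_mod_cast hn2
          exact mul_le_mul_of_nonneg_right this Real.pi_pos.le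
        linarith
  -- Since μ₂ > 0 the field is nonnegative: the angle increases from 0 to 2π, and a point z where it
  -- equals π separates the signs of sin θ.
  have hθmono : MonotoneOn (θ μ₂) (Icc (-ℓ) ℓ) :=
    monotoneOn_Icc_of_hasDerivAt_nonneg (hθ.continuousOn μ₂)
      (fun x hx => hθ.hasDerivAt μ₂ x (Ioo_subset_Icc_self hx)) fun x _ => by
        have := hP0 x
        have := hρ0 x
        unfold angleField
        positivity
  obtain ⟨z, hz, hθz⟩ := intermediate_value_Icc hlt.le (hθ.continuousOn μ₂)
    (show Real.pi ∈ Icc (θ μ₂ (-ℓ)) (θ μ₂ ℓ) by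
      rw [hθ.left, hθ₂]; constructor <;> linarith [Real.pi_pos])
  refine ⟨μ₂, fun x => r μ₂ x * Real.sin (θ μ₂ x), fun x => r μ₂ x * Real.cos (θ μ₂ x), z,
    hsecond, hrV μ₂, hrN μ₂, hz, by simp [hθ.left], by simp [hθz], by simp [hθ₂],
    by simpa [hθ.left] using hr0 μ₂ _, by simpa [hθz] using hr0 μ₂ z,
    by simpa [hθ₂] using hr0 μ₂ _, fun x hx => ?_, fun x hx => ?_⟩
  · have hx' : x ∈ Icc (-ℓ) ℓ := ⟨hx.1, hx.2.trans hz.2⟩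
    have h1 := hθmono (left_mem_Icc.2 hlt.le) hx' hx.1
    have h2 := hθmono hx' hz hx.2
    rw [hθ.left] at h1
    rw [hθz] at h2
    exact mul_nonneg (hr0 μ₂ x).le (Real.sin_nonneg_of_nonneg_of_le_pi h1 h2)
  · have hx' : x ∈ Icc (-ℓ) ℓ := ⟨hz.1.trans hx.1, hx.2⟩
    have h1 := hθmono hz hx' hx.1
    have h2 := hθmono hx' (right_mem_Icc.2 hlt.le) hx.2
    rw [hθz] at h1
    rw [hθ₂] at h2
    have h3 := Real.sin_nonneg_of_nonneg_of_le_pi (x := θ μ₂ x - Real.pi) (by linarith)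
      (by linarith)
    rw [Real.sin_sub_pi] at h3
    exact mul_nonpos_of_nonneg_of_nonpos (hr0 μ₂ x).le (by linarith)

end DiffusionTransport

/-! ### The bound on the second eigenvalue -/

theorem proposition4p3 (ℓ ξ am ap ε₁ : ℝ) (hξ : ξ ∈ Set.Ioo (-ℓ) ℓ) (hap : ap < 0) (ham : 0 < am)
    (hε₁ : 0 < ε₁) (a : ℝ → ℝ → ℝ)
    (hcont : ∀ ε ∈ Set.Ioo 0 ε₁, ContinuousOn (a ε) (Set.Icc (-ℓ) ℓ))
    (hA1 : ∀ ε ∈ Set.Ioo 0 ε₁, DiffusionTransport.HypA1 ℓ ξ (a ε))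
    (hA2 : DiffusionTransport.HypA2 ℓ ξ am ap ε₁ a)
    (hA3 : DiffusionTransport.HypA3 ξ ε₁ a) :
    ∃ C : ℝ, 0 < C ∧ ∃ ε₀ : ℝ, 0 < ε₀ ∧ ε₀ ≤ ε₁ ∧ ∀ ε ∈ Set.Ioo 0 ε₀,
      ∃ lam₂ : ℝ, DiffusionTransport.IsSecondEigenvalue ℓ ε (a ε) lam₂ ∧ lam₂ ≤ -C / ε := by
  have hℓ : 0 < ℓ := by linarith [hξ.1, hξ.2]
  have hle : -ℓ ≤ ℓ := by linarith
  set m : ℝ := min am (-ap) / 2 with hm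
  have hm0 : 0 < m := by
    have : 0 < min am (-ap) := lt_min ham (neg_pos.2 hap)
    positivity
  have hm1 : 2 * m ≤ am := by linarith [min_le_left am (-ap)]
  have hm2 : 2 * m ≤ -ap := by linarith [min_le_right am (-ap)]
  -- Both limit speeds are at least 2m, so a deviation of at most m leaves a drift of at least m at
  -- distance c ε or more from ξ.
  obtain ⟨c, hc0, hc⟩ := hA2 m hm0
  set δ : ℝ := min (Real.exp (-c) / 8) (m / 4) with hδdef
  have hδ : 0 < δ := lt_min (by positivity) (by positivity)
  have hδc : 8 * δ ≤ Real.exp (-c) := by linarith [min_le_left (Real.exp (-c) / 8) (m / 4)]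
  have hδm : 4 * δ ≤ m := by linarith [min_le_right (Real.exp (-c) / 8) (m / 4)]
  refine ⟨δ * min (Real.exp (-c)) m / 2, ?_, ε₁, hε₁, le_rfl, fun ε hε => ?_⟩
  · have : 0 < min (Real.exp (-c)) m := lt_min (Real.exp_pos _) hm0
    positivity
  have h1 := hA1 ε hε
  obtain ⟨B, hB⟩ := h1.exists_abs_deriv_le hξ (hcont ε hε) (hA3.left_differentiable ε hε)
    (hA3.right_differentiable ε hε)
  -- Extending a continuously, by its endpoint values, makes ρ differentiable on the whole line.
  set b : ℝ → ℝ := IccExtend hle ((Icc (-ℓ) ℓ).domRestrict (a ε)) with hbdef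
  have hb : Continuous b :=
    (continuousOn_iff_continuous_domRestrict.1 (hcont ε hε)).Icc_extend'
  have hab : EqOn b (a ε) (Icc (-ℓ) ℓ) := fun x hx => by
    rw [hbdef, IccExtend_of_mem _ _ hx]; rfl
  have hρ : ∀ x, HasDerivAt (fun x => Real.exp ((∫ t in (0 : ℝ)..x, b t) / ε))
      (Real.exp ((∫ t in (0 : ℝ)..x, b t) / ε) * b x / ε) x := fun x => by
    rw [mul_div_assoc]
    exact ((hb.integral_hasStrictDerivAt 0 x).hasDerivAt.div_const ε).exp
  have hρ0 : ∀ x, 0 < Real.exp ((∫ t in (0 : ℝ)..x, b t) / ε) := fun x => Real.exp_pos _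
  obtain ⟨μ, V, N, z, hsecond, hV, hN, hz, hV0, hVz, hVℓ, hN0, hNz, hNℓ, hVpos, hVneg⟩ :=
    DiffusionTransport.exists_isSecondEigenvalue hℓ hε.1 hb hab h1.differentiable hB hρ0 hρ
  refine ⟨-μ, hsecond, ?_⟩
  rw [neg_div]
  refine neg_le_neg ?_
  -- The nodal interval that misses ξ is used: (-ℓ, z) with σ = 1, or (z, ℓ) with σ = -1 and the
  -- signs of V and N reversed.
  rcases le_total z ξ with hzξ | hzξ
  · have hsub : ∀ x ∈ Ioo (-ℓ) z, x ∈ Ioo (-ℓ) ξ := fun x hx => ⟨hx.1, hx.2.trans_le hzξ⟩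
    have hsub' : ∀ x ∈ Ioo (-ℓ) z, x ∈ Ioo (-ℓ) ℓ := fun x hx => ⟨hx.1, hx.2.trans_le hz.2⟩
    refine DiffusionTransport.le_of_drift_towards (ξ := ξ) (σ := 1) hz.1 hε.1 (by norm_num)
      hδ hδc hδm hρ0 hρ (fun x hx => hV x ⟨hx.1, hx.2.trans hz.2⟩)
      (fun x hx => hN x ⟨hx.1, hx.2.trans hz.2⟩) (fun x hx => by linarith [(hsub x hx).2])
      (fun x hx => ?_) (fun x hx hfar => ?_) (fun x hx => hVpos x (Ioo_subset_Icc_self hx))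
      hV0 hVz hN0 hNz
    · rw [one_mul, hab (Ioo_subset_Icc_self (hsub' x hx))]
      exact (h1.left x (hsub x hx)).2.2.le
    · rw [one_mul, hab (Ioo_subset_Icc_self (hsub' x hx))]
      have h := (hc ε hε x (hsub' x hx)
        (by rw [abs_of_neg (by linarith [(hsub x hx).2])]; linarith)).1
      rw [DiffusionTransport.stepFunction, if_pos (hsub x hx).2] at h
      linarith [(abs_le.1 h).1]
  · have hsub : ∀ x ∈ Ioo z ℓ, x ∈ Ioo ξ ℓ := fun x hx => ⟨hzξ.trans_lt hx.1, hx.2⟩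
    have hsub' : ∀ x ∈ Ioo z ℓ, x ∈ Ioo (-ℓ) ℓ := fun x hx => ⟨hz.1.trans_lt hx.1, hx.2⟩
    refine DiffusionTransport.le_of_drift_towards (ξ := ξ) (σ := -1) (v := fun x => -V x)
      (J := fun x => -N x) hz.2 hε.1 (by norm_num)
      hδ hδc hδm hρ0 hρ (fun x hx => ?_) (fun x hx => ?_)
      (fun x hx => by linarith [(hsub x hx).1])
      (fun x hx => ?_) (fun x hx hfar => ?_)
      (fun x hx => neg_nonneg.2 (hVneg x (Ioo_subset_Icc_self hx)))
      (by simp [hVz]) (by simp [hVℓ]) (by simpa using hNz) (by simpa using hNℓ)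
    · simpa using (hV x ⟨hz.1.trans hx.1, hx.2⟩).fun_neg
    · simpa using (hN x ⟨hz.1.trans hx.1, hx.2⟩).fun_neg
    · rw [hab (Ioo_subset_Icc_self (hsub' x hx))]
      linarith [(h1.right x (hsub x hx)).1]
    · rw [hab (Ioo_subset_Icc_self (hsub' x hx))]
      have h := (hc ε hε x (hsub' x hx)
        (by rw [abs_of_pos (by linarith [(hsub x hx).1])]; linarith)).1
      rw [DiffusionTransport.stepFunction, if_neg (hsub x hx).1.not_gt] at h
      linarith [(abs_le.1 h).2]
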